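/- **Notation.** Let $n\ge 2$, let $\sigma$ be the surface measure on the unit sphere $S^{n-1}\subset\mathbb R^n$, $s_n=2\pi^{n/2}/\Gamma(n/2)$, and let $e_1,\dots,e_n$ be the canonical basis. "Uniform on $A\subseteq S^{n-1}$" means distributed according to $\sigma(\cdot\cap A)/\sigma(A)$. For a unit vector $\mu$ put $\mathrm{Cap}(\mu,\theta)=\{x\in S^{n-1}: x\cdot\mu\ge\cos\theta\}$, and put $$\Theta(\theta)=\frac{1}{B(\frac{n-1}2,\frac12)}\int_0^\theta\sin^{n-2}t\,dt .$$ Let $0<\theta_0\le\pi$. Random variables that are drawn separately are independent. $Z_1,Z_2,\dots$ denote independent standard normal variables. **The map $\Theta$.** $\Theta$ is a strictly increasing bijection $[0,\pi]\to[0,1]$, with inverse $\Theta^{-1}$, and $\sigma(\mathrm{Cap}(\mu,\theta))=s_n\Theta(\theta)$ for every unit vector $\mu$ and $\theta\in[0,\pi]$. The function $$f(\theta)=\frac{s_{n-1}}{s_n\Theta(\theta_0)}\sin^{n-2}\theta\ \text{ on } [0,\theta_0],\qquad f=0 \text{ elsewhere},$$ is a probability density. Its distribution function is $\Theta(\theta)/\Theta(\theta_0)$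 for $0\le\theta\le\theta_0$ and $1$ for $\theta>\theta_0$. 1. *(Sphere.)* For $m\ge1$, $(Z_1,\dots,Z_m)/\sqrt{Z_1^2+\dots+Z_m^2}$ is uniform on the unit sphere of $\mathbb R^m$. 2. *(Angle by inverse transform.)* If $U$ is uniform on $[0,\Theta(\theta_0)]$, then $\Theta^{-1}(U)$ has density $f$. 3. *(Angle by rejection.)* Let $h=(n-2)\log\sin\min(\theta_0,\frac\pi2)$. Draw repeatedly $U$ uniform on $[0,1]$ and $\theta$ uniform on $[0,\theta_0]$ until $h+\log U<(n-2)\log\sin\theta$, and return the last $\theta$. This terminates almost surely, the result has density $f$, and the expected number of passes is $$\frac1{\sqrt\pi}\,\frac{\Gamma(\frac n2)}{\Gamma(\frac{n-1}2)}\,\frac{\theta_0\,\sin^{n-2}(\min(\theta_0,\frac\pi2))}{\Theta(\theta_0)} .$$ 4. *(Cap about $e_n$.)* If $\theta$ has density $f$ and $s=(Z_1,\dots,Z_{n-1})/\sqrt{Z_1^2+\dots+Z_{n-1}^2}$ (in the span of $e_1,\dots,e_{n-1}$), with $\theta$ independent of the $Z_i$, then $\sin\theta\, s+\cos\theta\,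 e_n$ is uniform on $\mathrm{Cap}(e_n,\theta_0)$. 5. *(Rotation.)* Let $\mu$ be a unit vector, $\mu_n=\mu\cdot e_n$, and $$P=\Big[e_n\ \ \tfrac{\mu-\mu_ne_n}{\|\mu-\mu_ne_n\|}\Big],\qquad G=\begin{bmatrix}\mu_n&-\sqrt{1-\mu_n^2}\\ \sqrt{1-\mu_n^2}&\mu_n\end{bmatrix},$$ where the second column of $P$ is read as $0$ if $\mu=\pm e_n$. The linear map $R_\mu x=x+P(G-I_2)P^{T}x$ preserves the norm, sends $e_n$ to $\mu$, fixes every vector orthogonal to $e_n$ and $\mu$, and is a rotation (it belongs to $SO(n)$) if $\mu\ne-e_n$. If $X$ is uniform on $\mathrm{Cap}(e_n,\theta_0)$, then $R_\mu X$ is uniform on $\mathrm{Cap}(\mu,\theta_0)$. The rotation procedure that forms the second column of $P$ with entries $\mu_i/\sqrt{1-\mu_n^2}$ for $i<n$ and $0$ for $i=n$ computes $R_\mu x$. 6. *(Overall algorithm.)* The algorithm that generates $\theta$ as in 2 or as in 3, forms the vector of 4 and applies $R_\mu$, returns a uniform point of $\mathrm{Cap}(\mu,\theta_0)$. 7. *(Hollow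 cone.)* Let $0\le\Omega_1<\Omega_2\le1$, $\theta_i=\Theta^{-1}(\Omega_i)$, let $U$ be uniform on $[0,1]$, and use $\theta=\Theta^{-1}(U(\Omega_2-\Omega_1)+\Omega_1)$ instead. Then $R_\mu(\sin\theta\, s+\cos\theta\, e_n)$ is uniform on $\{x\in S^{n-1}:\cos\theta_1\ge x\cdot\mu\ge\cos\theta_2\}$. 8. *(Cost.)* Count as one operation each arithmetic operation, comparison or assignment of reals, each evaluation of $\sqrt{\ }$, $\sin$, $\cos$, $\log$, $\Theta$ or $\Theta^{-1}$, and each scalar random number. There is an absolute constant $C$ such that, for all $n\ge2$, $\mu$, $\theta_0$, $\Omega_1,\Omega_2$, the algorithm uses at most $Cn$ operations with the inverse transform (also for the hollow cone), and at most $Cn$ operations in expectation with rejection. -/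

import Mathlib

open MeasureTheory ProbabilityTheory Set
open scoped ENNReal Matrix

universe u

noncomputable section

namespace CapSampling

/-! The ambient dimension is `n = d + 2 ≥ 2`, so that `n - 2 = d` and `n - 1 = d + 1`;
the `n`-th coordinate has index `Fin.last (d + 1)`. -/

/-! ### Geometry -/

/-- The surface area measure of the unit sphere of `ℝⁿ`, as a measure on `ℝⁿ`. -/
def surfaceMeasure (n : ℕ) : Measure (EuclideanSpace ℝ (Fin n)) :=
  ((volume : Measure (EuclideanSpace ℝ (Fin n))).toSphere).map Subtype.val

/-- `sₙ = 2 π^(n/2) / Γ(n/2)`, the surface area of the unit sphere of `ℝⁿ`. -/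
def sphereArea (n : ℕ) : ℝ :=
  2 * Real.pi ^ ((n : ℝ) / 2) / Real.Gamma ((n : ℝ) / 2)

/-- The last canonical basis vector `eₙ`. -/
def axis (d : ℕ) : EuclideanSpace ℝ (Fin (d + 2)) :=
  EuclideanSpace.single (Fin.last (d + 1)) 1

/-- The spherical cap about `μ` of planar angle `θ`. -/
def cap {d : ℕ} (μ : EuclideanSpace ℝ (Fin (d + 2))) (θ : ℝ) :
    Set (EuclideanSpace ℝ (Fin (d + 2))) :=
  {x | ‖x‖ = 1 ∧ Real.cos θ ≤ inner ℝ x μ}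

/-- The hollow cone about `μ` between the planar angles `θ₁` and `θ₂`. -/
def hollowCone {d : ℕ} (μ : EuclideanSpace ℝ (Fin (d + 2))) (θ₁ θ₂ : ℝ) :
    Set (EuclideanSpace ℝ (Fin (d + 2))) :=
  {x | ‖x‖ = 1 ∧ inner ℝ x μ ≤ Real.cos θ₁ ∧ Real.cos θ₂ ≤ inner ℝ x μ}

/-- The map `Θ` from the planar angle to the solid angle fraction in dimension `n = d + 2`:
`Θ(θ) = B((n-1)/2, 1/2)⁻¹ ∫₀^θ sin^(n-2)`. -/
def solidFrac (d : ℕ) (θ : ℝ) : ℝ :=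
  (∫ t in (0 : ℝ)..θ, Real.sin t ^ d) / beta (((d : ℝ) + 1) / 2) (1 / 2)

/-- The inverse `Θ⁻¹ : [0,1] → [0,π]`. -/
def solidFracInv (d : ℕ) : ℝ → ℝ :=
  Function.invFunOn (solidFrac d) (Icc 0 Real.pi)

/-- The density `s_{n-1} / (sₙ Θ(θ₀)) · sin^(n-2) θ` on `[0, θ₀]`, zero elsewhere. -/
def angleDensity (d : ℕ) (θ₀ θ : ℝ) : ℝ :=
  (Icc 0 θ₀).indicator
    (fun t => sphereArea (d + 1) / (sphereArea (d + 2) * solidFrac d θ₀) * Real.sin t ^ d) θ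

/-- The law on `ℝ` with density `angleDensity d θ₀`. -/
def angleLaw (d : ℕ) (θ₀ : ℝ) : Measure ℝ :=
  volume.withDensity fun θ => ENNReal.ofReal (angleDensity d θ₀ θ)

/-- `z / ‖z‖` with the Euclidean norm. -/
def normalized {m : ℕ} (z : Fin m → ℝ) : EuclideanSpace ℝ (Fin m) :=
  WithLp.toLp 2 fun i => z i / √(∑ j, z j ^ 2)

/-- `sin θ · (z₁e₁ + ⋯ + z_{n-1}e_{n-1}) / √(z₁² + ⋯ + z_{n-1}²) + cos θ · eₙ`. -/
def capPoint {d : ℕ} (θ : ℝ) (z : Fin (d + 1) → ℝ) : EuclideanSpace ℝ (Fin (d + 2)) :=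
  Real.sin θ • (∑ i, normalized z i • EuclideanSpace.single i.castSucc (1 : ℝ))
    + Real.cos θ • axis d

/-- `P = [eₙ, (μ - μₙeₙ)/‖μ - μₙeₙ‖]`. If `μ = ±eₙ` the second column is zero. -/
def planeBasis {d : ℕ} (μ : EuclideanSpace ℝ (Fin (d + 2))) : Matrix (Fin (d + 2)) (Fin 2) ℝ :=
  Matrix.of fun i j =>
    ![axis d i,
      (‖μ - μ (Fin.last (d + 1)) • axis d‖⁻¹ • (μ - μ (Fin.last (d + 1)) • axis d)) i] j

/-- The two-dimensional Givens matrix `G` of the rotation, with `c = μₙ`. -/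
def givens (c : ℝ) : Matrix (Fin 2) (Fin 2) ℝ :=
  !![c, -√(1 - c ^ 2); √(1 - c ^ 2), c]

/-- `I + P (G - I₂) Pᵀ`. -/
def rotationMatrix {d : ℕ} (μ : EuclideanSpace ℝ (Fin (d + 2))) :
    Matrix (Fin (d + 2)) (Fin (d + 2)) ℝ :=
  1 + planeBasis μ * (givens (μ (Fin.last (d + 1))) - 1) * (planeBasis μ)ᵀ

/-- `x ↦ x + P (G - I₂) Pᵀ x`. -/
def rotate {d : ℕ} (μ x : EuclideanSpace ℝ (Fin (d + 2))) : EuclideanSpace ℝ (Fin (d + 2)) :=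
  WithLp.toLp 2 (x.ofLp +
    planeBasis μ *ᵥ ((givens (μ (Fin.last (d + 1))) - 1) *ᵥ ((planeBasis μ)ᵀ *ᵥ x.ofLp)))

/-! ### Algorithms with an operation count

The value of `Counted α` is a result together with the number of elementary operations spent.
Elementary operations, each of unit cost: one arithmetic operation, comparison or assignment on
reals, one evaluation of `√`, `sin`, `cos`, `log`, `Θ` or `Θ⁻¹`, and one call to a scalar random
number generator. The random numbers obtained are passed as arguments. -/

structure Counted (α : Type) where
  val : α
  ops : ℕ

instance : Monad Counted where
  pure a := ⟨a, 0⟩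
  bind x f := ⟨(f x.val).val, x.ops + (f x.val).ops⟩

/-- One elementary operation with result `a`. -/
def tick {α : Type} (a : α) : Counted α := ⟨a, 1⟩

/-- The loop `for i = 1:m`, `x[i] ← f i`. -/
def forVec {m : ℕ} (f : Fin m → Counted ℝ) : Counted (Fin m → ℝ) :=
  ⟨fun i => (f i).val, ∑ i, (f i).ops⟩

/-- The loop `for i = 1:m`, `acc ← acc + f i`. -/
def forSum {m : ℕ} (f : Fin m → Counted ℝ) : Counted ℝ :=
  ⟨∑ i, (f i).val, ∑ i, ((f i).ops + 1)⟩

/-- Matrix times vector by the definition, one dot product per row. -/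
def mulVecC {p q : ℕ} (A : Matrix (Fin p) (Fin q) ℝ) (v : Fin q → ℝ) : Counted (Fin p → ℝ) :=
  forVec fun i => forSum fun j => tick (A i j * v j)

/-- `repeat body until true`, where `body k` is the `k`-th pass (counted from `0`); returns the
index of the last pass. (A loop that never ends gets a default value.) -/
def repeatUntil (body : ℕ → Counted Prop) : Counted ℕ :=
  ⟨sInf {k | (body k).val},
    ∑ k ∈ Finset.range (sInf {k | (body k).val} + 1), (body k).ops⟩

/-- Generate a point on the sphere from the normal random numbers `z`. -/
def spherePointAlg {m : ℕ} (z : Fin m → ℝ) : Counted (Fin m → ℝ) := do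
  let x ← forVec fun i => tick (z i)
  let r2 ← forSum fun i => tick (x i ^ 2)
  let r ← tick (√r2)
  forVec fun i => tick (x i / r)

/-- Rotate `x` from around the last basis vector to the orientation `μ`. -/
def rotateAlg {d : ℕ} (x μ : Fin (d + 2) → ℝ) : Counted (Fin (d + 2) → ℝ) := do
  let p₁ ← forVec fun i : Fin (d + 2) => tick (if i = Fin.last (d + 1) then 1 else 0)
  let c ← tick (μ (Fin.last (d + 1)))
  let c2 ← tick (c ^ 2)
  let s2 ← tick (1 - c2)
  let s ← tick (√s2)
  let p₂ ← forVec fun i => tick (if i = Fin.last (d + 1) then 0 else μ i / s)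
  let s' ← tick (-s)
  let a ← tick (c - 1)
  let b ← tick (s' - 0)
  let b' ← tick (s - 0)
  let a' ← tick (c - 1)
  let P : Matrix (Fin (d + 2)) (Fin 2) ℝ := Matrix.of fun i j => ![p₁ i, p₂ i] j
  let u ← mulVecC Pᵀ x
  let v ← mulVecC !![a, b; b', a'] u
  let w ← mulVecC P v
  forVec fun i => tick (x i + w i)

/-- Generate the planar angle by inverse transform; `u` is the random number drawn uniformly
between `0` and `Θ(θ₀)`. -/
def inverseAngleAlg (d : ℕ) (θ₀ : ℝ) (u : ℝ → ℝ) : Counted ℝ := do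
  let Ω₀ ← tick (solidFrac d θ₀)
  let y ← tick (u Ω₀)
  tick (solidFracInv d y)

/-- One pass of the rejection loop, with the random numbers `u` and `t` drawn in it; the result
is the stopping test `h + log u < (n - 2) log (sin t)`. -/
def rejectionPass (d : ℕ) (h u t : ℝ) : Counted Prop := do
  let u ← tick u
  let t ← tick t
  let l ← tick (Real.log u)
  let f ← tick (h + l)
  let s ← tick (Real.sin t)
  let l' ← tick (Real.log s)
  let g ← tick ((d : ℝ) * l')
  tick (f < g)

/-- The number `h = (n - 2) log (sin (min (θ₀, π/2)))`. -/
def rejectionLevel (d : ℕ) (θ₀ : ℝ) : ℝ :=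
  (d : ℝ) * Real.log (Real.sin (min θ₀ (Real.pi / 2)))

/-- Generate the planar angle by rejection; `u k` and `t k` are the random numbers drawn in the
`k`-th pass, uniformly on `[0,1]` and on `[0,θ₀]`. -/
def rejectionAngleAlg (d : ℕ) (θ₀ : ℝ) (u t : ℕ → ℝ) : Counted ℝ := do
  let a ← tick (min θ₀ (Real.pi / 2))
  let s ← tick (Real.sin a)
  let l ← tick (Real.log s)
  let h ← tick ((d : ℝ) * l)
  let N ← repeatUntil fun k => rejectionPass d h (u k) (t k)
  pure (t N)

/-- The number of passes made by the rejection loop. -/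
def rejectionPasses (d : ℕ) (θ₀ : ℝ) (u t : ℕ → ℝ) : ℕ :=
  (repeatUntil fun k => rejectionPass d (rejectionLevel d θ₀) (u k) (t k)).val + 1

/-- Generate the planar angle of a hollow cone; `u` is uniform on `[0,1]`. -/
def hollowAngleAlg (d : ℕ) (Ω₁ Ω₂ u : ℝ) : Counted ℝ := do
  let u ← tick u
  let Δ ← tick (Ω₂ - Ω₁)
  let p ← tick (u * Δ)
  let y ← tick (p + Ω₁)
  tick (solidFracInv d y)

/-- Generate a point on the spherical cap (or hollow cone), given a procedure for the planar
angle and the normal random numbers `z`. -/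
def capPointAlg {d : ℕ} (angle : Counted ℝ) (z : Fin (d + 1) → ℝ) (μ : Fin (d + 2) → ℝ) :
    Counted (Fin (d + 2) → ℝ) := do
  let θ ← angle
  let s ← spherePointAlg z
  let r ← tick (Real.sin θ)
  let y ← forVec fun i => tick (r * s i)
  let c ← tick (Real.cos θ)
  rotateAlg (Fin.snoc (α := fun _ => ℝ) y c) μ

/-! ### Randomness -/

/-- Independent standard normal random variables. -/
def IsStdNormalFamily {Ω : Type*} [MeasurableSpace Ω] (P : Measure Ω) {m : ℕ}
    (Z : Fin m → Ω → ℝ) : Prop :=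
  iIndepFun Z P ∧ ∀ i, HasLaw (Z i) (gaussianReal 0 1) P

/-- The draws of the rejection loop: all independent, `U k` uniform on `[0,1]`, `T k` uniform
on `[0,θ₀]`. -/
def IsRejectionSource {Ω : Type*} [MeasurableSpace Ω] (P : Measure Ω) (θ₀ : ℝ)
    (U T : ℕ → Ω → ℝ) : Prop :=
  iIndepFun (fun k ω => (U k ω, T k ω)) P ∧
  (∀ k, IndepFun (U k) (T k) P) ∧
  (∀ k, pdf.IsUniform (U k) (Icc 0 1) P) ∧
  (∀ k, pdf.IsUniform (T k) (Icc 0 θ₀) P)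

end CapSampling

end

open CapSampling

namespace CapSampling

/-! ### Polar coordinates -/

/-! Write `n = d + 2`. The core is `surfaceMeasure_eq_map_polarPoint`: in the coordinates `sin θ • s
+ cos θ • eₙ`, the surface measure is the product of `sin θ ^ d dθ` on `[0, π]` and the surface
measure one dimension lower. To see this, the Lebesgue integral of `g ‖x‖ * h (x / ‖x‖)` is computed
twice: in polar coordinates of `ℝⁿ`, and by splitting off the last coordinate, passing to polar
coordinates in the others, then to planar polar coordinates for the pair (last coordinate, radius).
Both results carry the same radial factor, which cancels. The same cancellation transfers isometry
invariance from Lebesgue measure to the sphere, and a radial Gaussian density makes the normalized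
normal vector uniform.

In these coordinates a hollow cone about `eₙ` is almost everywhere a rectangle, an interval of
angles times the whole lower sphere. A point is therefore uniform on it once its direction is
uniform, independent of the angle, and the angle has the law `sin ^ d` conditioned to the interval.
Caps are hollow cones with inner angle `0`. The isometry `rotate μ` maps `eₙ` to `μ`, so it carries
cones about `eₙ` to cones about `μ`. Most normalizing constants are never computed: a probability
measure proportional to a restriction is the conditional measure (`eq_cond_of_eq_smul`).

There are two sources of the angle. Up to a constant, `Θ` is the distribution function of `sin ^ d`,
which gives the inverse transform. In the rejection loop, a draw `t` is accepted with probability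
`(sin t / M) ^ d`, where `M` is the maximum of `sin` on `[0, θ₀]`. The first success among
independent trials has the conditional law, and its mean waiting time is the inverse of the success
probability. Concavity of `sin` bounds that mean by `2 * (d + 1)`. Each pass costs a constant and
the remaining work is linear in `n`, so the expected cost is linear too. -/

theorem lintegral_surfaceMeasure (n : ℕ) {f : EuclideanSpace ℝ (Fin n) → ℝ≥0∞}
    (hf : Measurable f) :
    ∫⁻ x, f x ∂surfaceMeasure n =
      ∫⁻ x, f x.1 ∂(volume : Measure (EuclideanSpace ℝ (Fin n))).toSphere :=
  lintegral_map hf measurable_subtype_coe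

instance (n : ℕ) : IsFiniteMeasure (surfaceMeasure n) := by
  unfold surfaceMeasure; infer_instance

theorem ae_surfaceMeasure_norm (n : ℕ) : ∀ᵐ x ∂surfaceMeasure n, ‖x‖ = 1 := by
  unfold surfaceMeasure
  rw [ae_map_iff measurable_subtype_coe.aemeasurable
    (measurableSet_eq_fun measurable_norm measurable_const)]
  exact .of_forall fun x => by simp

theorem lintegral_volumeIoiPow (n : ℕ) {g : ℝ → ℝ≥0∞} (hg : Measurable g) :
    ∫⁻ r, g r.1 ∂Measure.volumeIoiPow n = ∫⁻ r in Ioi (0 : ℝ), ENNReal.ofReal (r ^ n) * g r := by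
  rw [Measure.volumeIoiPow, lintegral_withDensity_eq_lintegral_mul _ (by fun_prop)
    (by fun_prop)]
  exact lintegral_subtype_comap measurableSet_Ioi fun r : ℝ => ENNReal.ofReal (r ^ n) * g r

/-- Integration in polar coordinates. -/
theorem lintegral_polar (n : ℕ) {f : EuclideanSpace ℝ (Fin (n + 1)) → ℝ≥0∞}
    (hf : Measurable f) :
    ∫⁻ x, f x = ∫⁻ r in Ioi (0 : ℝ), ENNReal.ofReal (r ^ n) *
      ∫⁻ s, f (r • s) ∂surfaceMeasure (n + 1) := by
  have hmp := Measure.measurePreserving_homeomorphUnitSphereProd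
    (volume : Measure (EuclideanSpace ℝ (Fin (n + 1))))
  have hdim : Module.finrank ℝ (EuclideanSpace ℝ (Fin (n + 1))) - 1 = n := by simp
  rw [hdim] at hmp
  have hm : Measurable fun p : Metric.sphere (0 : EuclideanSpace ℝ (Fin (n + 1))) 1 × Ioi (0 : ℝ) =>
      f (p.2.1 • p.1.1) := by fun_prop
  have h1 := hmp.lintegral_comp hm
  have h2 : ∀ x : ({0}ᶜ : Set (EuclideanSpace ℝ (Fin (n + 1)))),
      f (((homeomorphUnitSphereProd (EuclideanSpace ℝ (Fin (n + 1)))) x).2.1 •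
        ((homeomorphUnitSphereProd (EuclideanSpace ℝ (Fin (n + 1)))) x).1.1) = f x := by
    intro x
    have : ‖(x : EuclideanSpace ℝ (Fin (n + 1)))‖ ≠ 0 := norm_ne_zero_iff.2 x.2
    simp [smul_smul, mul_inv_cancel₀ this]
  simp_rw [h2] at h1
  -- The polar homeomorphism lives off the origin, which is a null set.
  rw [lintegral_subtype_comap (measurableSet_singleton _).compl, restrict_compl_singleton] at h1
  have hm2 : Measurable fun r : ℝ => ∫⁻ s, f (r • s) ∂surfaceMeasure (n + 1) :=
    Measurable.lintegral_prod_right' (f := fun p : ℝ × EuclideanSpace ℝ (Fin (n + 1)) =>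
      f (p.1 • p.2)) (by fun_prop)
  rw [h1, lintegral_prod_symm' _ hm, ← lintegral_volumeIoiPow n hm2]
  refine lintegral_congr fun r => ?_
  rw [lintegral_surfaceMeasure _ (by fun_prop)]

/-- Integration of the product of a radial and an angular function. -/
theorem lintegral_radial_mul (n : ℕ) {g : ℝ → ℝ≥0∞} (hg : Measurable g)
    {h : EuclideanSpace ℝ (Fin (n + 1)) → ℝ≥0∞} (hh : Measurable h) :
    ∫⁻ x : EuclideanSpace ℝ (Fin (n + 1)), g ‖x‖ * h (‖x‖⁻¹ • x) =
      (∫⁻ r in Ioi (0 : ℝ), ENNReal.ofReal (r ^ n) * g r) *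
        ∫⁻ s, h s ∂surfaceMeasure (n + 1) := by
  rw [lintegral_polar n (by fun_prop), ← lintegral_mul_const _ (by fun_prop)]
  refine setLIntegral_congr_fun measurableSet_Ioi fun r (hr : 0 < r) => ?_
  rw [mul_assoc, ← lintegral_const_mul _ hh]
  congr 1
  refine lintegral_congr_ae ?_
  filter_upwards [ae_surfaceMeasure_norm (n + 1)] with s hs
  have : ‖r • s‖ = r := by simp [norm_smul, hs, hr.le]
  rw [this, smul_smul, inv_mul_cancel₀ hr.ne', one_smul]

/-- The point with coordinates `(y, t)`. -/
noncomputable def appendCoord {n : ℕ} (y : EuclideanSpace ℝ (Fin n)) (t : ℝ) :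
    EuclideanSpace ℝ (Fin (n + 1)) :=
  WithLp.toLp 2 (Fin.snoc (α := fun _ => ℝ) y.ofLp t)

@[simp]
theorem appendCoord_castSucc {n : ℕ} (y : EuclideanSpace ℝ (Fin n)) (t : ℝ) (i : Fin n) :
    appendCoord y t i.castSucc = y i := by simp [appendCoord]

@[simp]
theorem appendCoord_last {n : ℕ} (y : EuclideanSpace ℝ (Fin n)) (t : ℝ) :
    appendCoord y t (Fin.last n) = t := by simp [appendCoord]

theorem norm_appendCoord {n : ℕ} (y : EuclideanSpace ℝ (Fin n)) (t : ℝ) :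
    ‖appendCoord y t‖ = √(‖y‖ ^ 2 + t ^ 2) := by
  rw [EuclideanSpace.norm_eq, EuclideanSpace.norm_sq_eq, Fin.sum_univ_castSucc]
  simp

theorem smul_appendCoord {n : ℕ} (a : ℝ) (y : EuclideanSpace ℝ (Fin n)) (t : ℝ) :
    a • appendCoord y t = appendCoord (a • y) (a * t) := by
  ext i
  refine Fin.lastCases ?_ (fun i => ?_) i <;> simp

@[fun_prop]
theorem measurable_appendCoord {n : ℕ} :
    Measurable fun p : EuclideanSpace ℝ (Fin n) × ℝ => appendCoord p.1 p.2 := by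
  refine (WithLp.measurable_toLp 2 _).comp (measurable_pi_lambda _ fun i => ?_)
  refine Fin.lastCases ?_ (fun i => ?_) i
  · simpa using measurable_snd
  · simp only [Fin.snoc_castSucc]
    fun_prop

/-- Tonelli; `piFinSuccAbove` at `Fin.last n` puts the last coordinate first, so it becomes the
outer variable. -/
theorem lintegral_appendCoord (n : ℕ) {f : EuclideanSpace ℝ (Fin (n + 1)) → ℝ≥0∞}
    (hf : Measurable f) :
    ∫⁻ x, f x = ∫⁻ t : ℝ, ∫⁻ y : EuclideanSpace ℝ (Fin n), f (appendCoord y t) := by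
  rw [← (PiLp.volume_preserving_toLp (Fin (n + 1))).lintegral_comp hf,
    ← (volume_preserving_piFinSuccAbove (fun _ => ℝ) (Fin.last n)).symm.lintegral_comp
      (by fun_prop), Measure.volume_eq_prod, lintegral_prod _ (by fun_prop)]
  refine lintegral_congr fun t => ?_
  rw [← (PiLp.volume_preserving_toLp (Fin n)).lintegral_comp (by fun_prop)]
  refine lintegral_congr fun y => ?_
  congr 2
  simp [MeasurableEquiv.piFinSuccAbove, Fin.snocEquiv]

/-! ### Angular decomposition of the surface measure -/

/-- The measure on angles with density `sin ^ d` on `[0, π]`. -/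
noncomputable def sinPowMeasure (d : ℕ) : Measure ℝ :=
  (volume.restrict (Icc 0 Real.pi)).withDensity fun t => ENNReal.ofReal (Real.sin t ^ d)

/-- The point with polar angle `p.1` and direction `p.2`. -/
noncomputable def polarPoint {n : ℕ} (p : ℝ × EuclideanSpace ℝ (Fin n)) :
    EuclideanSpace ℝ (Fin (n + 1)) :=
  appendCoord (Real.sin p.1 • p.2) (Real.cos p.1)

@[fun_prop]
theorem measurable_polarPoint {n : ℕ} : Measurable (polarPoint (n := n)) := by
  unfold polarPoint
  exact measurable_appendCoord.comp (f := fun p : ℝ × EuclideanSpace ℝ (Fin n) =>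
    (Real.sin p.1 • p.2, Real.cos p.1)) (by fun_prop)

theorem norm_polarPoint {n : ℕ} (θ : ℝ) {s : EuclideanSpace ℝ (Fin n)} (hs : ‖s‖ = 1) :
    ‖polarPoint (θ, s)‖ = 1 := by
  simp [polarPoint, norm_appendCoord, norm_smul, hs]

theorem lintegral_sinPowMeasure (d : ℕ) {f : ℝ → ℝ≥0∞} (hf : Measurable f) :
    ∫⁻ θ, f θ ∂sinPowMeasure d =
      ∫⁻ θ in Ioo 0 Real.pi, ENNReal.ofReal (Real.sin θ ^ d) * f θ := by
  rw [sinPowMeasure, lintegral_withDensity_eq_lintegral_mul _ (by fun_prop) hf,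
    Measure.restrict_congr_set Ioo_ae_eq_Icc]
  rfl

/-- With `t` the last coordinate and `r` the norm of the others, set `(t, r) = (ρ cos θ, ρ sin θ)`.
The Jacobians `r ^ d` of the lower polar coordinates and `ρ` of the planar ones multiply to `ρ ^ (d
+ 1) * sin θ ^ d`, which separates. -/
theorem lintegral_radial_mul_polarPoint (d : ℕ) {g : ℝ → ℝ≥0∞} (hg : Measurable g)
    {h : EuclideanSpace ℝ (Fin (d + 2)) → ℝ≥0∞} (hh : Measurable h) :
    ∫⁻ x : EuclideanSpace ℝ (Fin (d + 2)), g ‖x‖ * h (‖x‖⁻¹ • x) =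
      (∫⁻ r in Ioi (0 : ℝ), ENNReal.ofReal (r ^ (d + 1)) * g r) *
        ∫⁻ θ, ∫⁻ s, h (polarPoint (θ, s)) ∂surfaceMeasure (d + 1) ∂sinPowMeasure d := by
  set F : EuclideanSpace ℝ (Fin (d + 2)) → ℝ≥0∞ := fun x => g ‖x‖ * h (‖x‖⁻¹ • x) with hF
  have hFm : Measurable F := by fun_prop
  have hinner : Measurable fun θ : ℝ => ∫⁻ s, h (polarPoint (θ, s)) ∂surfaceMeasure (d + 1) :=
    Measurable.lintegral_prod_right' (f := fun p => h (polarPoint p)) (by fun_prop)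
  have hFa : Measurable fun p : (ℝ × ℝ) × EuclideanSpace ℝ (Fin (d + 1)) =>
      F (appendCoord (p.1.2 • p.2) p.1.1) :=
    hFm.comp (measurable_appendCoord.comp
      (f := fun p : (ℝ × ℝ) × EuclideanSpace ℝ (Fin (d + 1)) => (p.1.2 • p.2, p.1.1))
      (by fun_prop))
  -- What remains to be integrated over the half-plane of pairs `(t, r)`, `r > 0`, after the
  -- directions have been integrated out.
  set K : ℝ × ℝ → ℝ≥0∞ := fun p => ENNReal.ofReal (p.2 ^ d) *
    ∫⁻ s, F (appendCoord (p.2 • s) p.1) ∂surfaceMeasure (d + 1) with hK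
  have hKm : Measurable K := by
    have := Measurable.lintegral_prod_right' (ν := surfaceMeasure (d + 1)) hFa
    fun_prop
  have hKpos : ∀ r θ : ℝ, 0 < r → 0 < Real.sin θ → K (r * Real.cos θ, r * Real.sin θ) =
      ENNReal.ofReal ((r * Real.sin θ) ^ d) *
        (g r * ∫⁻ s, h (polarPoint (θ, s)) ∂surfaceMeasure (d + 1)) := by
    intro r θ hr hs
    simp only [hK]
    congr 1
    rw [← lintegral_const_mul _ (by fun_prop)]
    refine lintegral_congr_ae ?_
    filter_upwards [ae_surfaceMeasure_norm (d + 1)] with s hsn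
    have : appendCoord ((r * Real.sin θ) • s) (r * Real.cos θ) = r • polarPoint (θ, s) := by
      rw [polarPoint, smul_appendCoord, smul_smul]
    have hn : ‖r • polarPoint (θ, s)‖ = r := by
      rw [norm_smul, norm_polarPoint θ hsn]; simp [hr.le]
    rw [this, hF]
    simp only
    rw [hn, smul_smul, inv_mul_cancel₀ hr.ne', one_smul]
  calc ∫⁻ x, F x = ∫⁻ t : ℝ, ∫⁻ r in Ioi (0 : ℝ), K (t, r) := by
        rw [lintegral_appendCoord _ hFm]
        refine lintegral_congr fun t => ?_
        rw [lintegral_polar d]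
        exact hFm.comp (measurable_appendCoord.comp
          (f := fun y : EuclideanSpace ℝ (Fin (d + 1)) => (y, t)) (by fun_prop))
    -- Extension by zero to the whole plane, where the planar polar formula is available.
    _ = ∫⁻ p : ℝ × ℝ, (univ ×ˢ Ioi (0 : ℝ)).indicator K p := by
        rw [lintegral_indicator (MeasurableSet.univ.prod measurableSet_Ioi),
          Measure.volume_eq_prod, ← Measure.prod_restrict, Measure.restrict_univ,
          lintegral_prod _ hKm.aemeasurable]
    _ = ∫⁻ p in Ioi (0 : ℝ) ×ˢ Ioo (-Real.pi) Real.pi, ENNReal.ofReal p.1 *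
          (univ ×ˢ Ioi (0 : ℝ)).indicator K (p.1 * Real.cos p.2, p.1 * Real.sin p.2) := by
        rw [← lintegral_comp_polarCoord_symm]
        rfl
    _ = ∫⁻ p in Ioi (0 : ℝ) ×ˢ Ioo (-Real.pi) Real.pi,
          (univ ×ˢ Ioo 0 Real.pi).indicator (fun p : ℝ × ℝ =>
            (ENNReal.ofReal (p.1 ^ (d + 1)) * g p.1)
            * (ENNReal.ofReal (Real.sin p.2 ^ d) *
              ∫⁻ s, h (polarPoint (p.2, s)) ∂surfaceMeasure (d + 1))) p := by
        refine setLIntegral_congr_fun (measurableSet_Ioi.prod measurableSet_Ioo) ?_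
        rintro ⟨r, θ⟩ ⟨hr, hθ⟩
        have hr : 0 < r := hr
        -- The half-plane `r > 0` is the sector `0 < θ < π`; for the other angles both indicators
        -- vanish.
        by_cases h0 : 0 < θ
        · have hs : 0 < Real.sin θ := Real.sin_pos_of_pos_of_lt_pi h0 hθ.2
          have h1 : ((r * Real.cos θ, r * Real.sin θ) : ℝ × ℝ) ∈ (univ : Set ℝ) ×ˢ Ioi (0 : ℝ) :=
            ⟨trivial, mul_pos hr hs⟩
          have h2 : ((r, θ) : ℝ × ℝ) ∈ (univ : Set ℝ) ×ˢ Ioo 0 Real.pi := ⟨trivial, h0, hθ.2⟩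
          simp only [indicator_of_mem h1, indicator_of_mem h2]
          rw [hKpos r θ hr hs, mul_pow, pow_succ, ENNReal.ofReal_mul (by positivity),
            ENNReal.ofReal_mul (by positivity)]
          ring
        · have hs : Real.sin θ ≤ 0 :=
            Real.sin_nonpos_of_nonpos_of_neg_pi_le (not_lt.1 h0) hθ.1.le
          have h1 : ((r * Real.cos θ, r * Real.sin θ) : ℝ × ℝ) ∉ (univ : Set ℝ) ×ˢ Ioi (0 : ℝ) :=
            fun hh => absurd hh.2 (not_lt.2 (mul_nonpos_of_nonneg_of_nonpos hr.le hs))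
          have h2 : ((r, θ) : ℝ × ℝ) ∉ (univ : Set ℝ) ×ˢ Ioo 0 Real.pi := fun hh => h0 hh.2.1
          simp only [indicator_of_notMem h1, indicator_of_notMem h2, mul_zero]
    _ = ∫⁻ p in Ioi (0 : ℝ) ×ˢ Ioo 0 Real.pi, (ENNReal.ofReal (p.1 ^ (d + 1)) * g p.1)
            * (ENNReal.ofReal (Real.sin p.2 ^ d) *
              ∫⁻ s, h (polarPoint (p.2, s)) ∂surfaceMeasure (d + 1)) := by
        rw [setLIntegral_indicator (MeasurableSet.univ.prod measurableSet_Ioo), prod_inter_prod,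
          univ_inter, Ioo_inter_Ioo]
        simp [Real.pi_pos.le]
    _ = _ := by
        rw [Measure.volume_eq_prod, ← Measure.prod_restrict,
          lintegral_prod_mul (f := fun r : ℝ => ENNReal.ofReal (r ^ (d + 1)) * g r)
            (g := fun θ : ℝ => ENNReal.ofReal (Real.sin θ ^ d) *
              ∫⁻ s, h (polarPoint (θ, s)) ∂surfaceMeasure (d + 1))
            (by fun_prop) (by fun_prop), lintegral_sinPowMeasure d hinner]

instance (d : ℕ) : IsFiniteMeasure (sinPowMeasure d) := by
  unfold sinPowMeasure
  refine isFiniteMeasure_withDensity_ofReal ?_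
  exact (((Real.continuous_sin.pow d).integrableOn_Icc (a := 0) (b := Real.pi))).2

/-- The radial factor belonging to the open unit ball; being neither zero nor infinite, it can be
cancelled in `ℝ≥0∞`. -/
theorem lintegral_pow_unitInterval_ne_zero_top (n : ℕ) :
    (∫⁻ r in Ioi (0 : ℝ), ENNReal.ofReal (r ^ n) * (Iio (1 : ℝ)).indicator 1 r) ≠ 0 ∧
    (∫⁻ r in Ioi (0 : ℝ), ENNReal.ofReal (r ^ n) * (Iio (1 : ℝ)).indicator 1 r) ≠ ∞ := by
  have hI : ∫⁻ r in Ioi (0 : ℝ), ENNReal.ofReal (r ^ n) * (Iio (1 : ℝ)).indicator 1 r =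
      ∫⁻ r in Ioo (0 : ℝ) 1, ENNReal.ofReal (r ^ n) := by
    rw [← Ioi_inter_Iio, inter_comm, ← setLIntegral_indicator measurableSet_Iio]
    refine lintegral_congr fun r => ?_
    by_cases hr : r ∈ Iio (1 : ℝ) <;> simp [hr]
  rw [hI]
  constructor
  · refine (setLIntegral_pos_iff (by fun_prop)).2 ?_ |>.ne'
    have : Ioo (0 : ℝ) 1 ⊆ (Function.support fun r => ENNReal.ofReal (r ^ n)) ∩ Ioo 0 1 :=
      fun r hr => ⟨by simp [pow_pos hr.1], hr⟩
    exact lt_of_lt_of_le (by simp) (measure_mono this)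
  · refine ne_of_lt (lt_of_le_of_lt (setLIntegral_mono (g := fun _ => 1) measurable_const ?_) ?_)
    · exact fun r hr => by simpa using pow_le_one₀ hr.1.le hr.2.le
    · simp

theorem measurable_indicator_Iio_one : Measurable ((Iio (1 : ℝ)).indicator (1 : ℝ → ℝ≥0∞)) :=
  measurable_one.indicator measurableSet_Iio

/-- The two evaluations of the integral of `h (x / ‖x‖)` over the unit ball have the same radial
factor, so their angular factors agree. -/
theorem surfaceMeasure_eq_map_polarPoint (d : ℕ) :
    surfaceMeasure (d + 2) =
      ((sinPowMeasure d).prod (surfaceMeasure (d + 1))).map polarPoint := by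
  refine Measure.ext_of_lintegral _ fun h hh => ?_
  rw [lintegral_map hh measurable_polarPoint, lintegral_prod _ (by fun_prop)]
  have hg := measurable_indicator_Iio_one
  have key := (lintegral_radial_mul (d + 1) hg hh).symm.trans
    (lintegral_radial_mul_polarPoint d hg hh)
  obtain ⟨h0, ht⟩ := lintegral_pow_unitInterval_ne_zero_top (d + 1)
  exact (ENNReal.mul_right_inj h0 ht).1 key

/-! ### Total mass and invariance of the surface measure -/

theorem sphereArea_pos (n : ℕ) : 0 < sphereArea (n + 1) := by
  have : 0 < Real.Gamma (((n + 1 : ℕ) : ℝ) / 2) := Real.Gamma_pos_of_pos (by positivity)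
  unfold sphereArea
  positivity

/-- The mass of the sphere is the dimension times the volume of the ball, and `Γ(x + 1) = x Γ(x)`
absorbs the dimension. -/
theorem surfaceMeasure_univ (n : ℕ) :
    surfaceMeasure (n + 1) univ = ENNReal.ofReal (sphereArea (n + 1)) := by
  rw [surfaceMeasure, Measure.map_apply measurable_subtype_coe .univ, preimage_univ,
    Measure.toSphere_apply_univ, EuclideanSpace.volume_ball]
  have hG : 0 < Real.Gamma (((n + 1 : ℕ) : ℝ) / 2) := Real.Gamma_pos_of_pos (by positivity)
  rw [Fintype.card_fin, Real.Gamma_add_one (by positivity), finrank_euclideanSpace_fin,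
    ENNReal.ofReal_one, one_pow, one_mul, ← ENNReal.ofReal_natCast,
    ← ENNReal.ofReal_mul (by positivity), sphereArea]
  congr 1
  rw [Real.sqrt_eq_rpow, ← Real.rpow_natCast (Real.pi ^ (1 / 2 : ℝ)),
    ← Real.rpow_mul Real.pi_pos.le]
  have : ((1 : ℝ) / 2 * ((n + 1 : ℕ) : ℝ)) = ((n + 1 : ℕ) : ℝ) / 2 := by ring
  rw [this]
  have : (((n + 1 : ℕ) : ℝ)) ≠ 0 := by positivity
  field_simp

/-- An isometry preserves Lebesgue measure and commutes with `x ↦ x / ‖x‖`; the radial factor over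
the unit ball then cancels. -/
theorem surfaceMeasure_map_linearIsometry (n : ℕ)
    (e : EuclideanSpace ℝ (Fin (n + 1)) ≃ₗᵢ[ℝ] EuclideanSpace ℝ (Fin (n + 1))) :
    (surfaceMeasure (n + 1)).map e = surfaceMeasure (n + 1) := by
  refine Measure.ext_of_lintegral _ fun h hh => ?_
  have he : Measurable e := e.continuous.measurable
  rw [lintegral_map hh he]
  obtain ⟨h0, ht⟩ := lintegral_pow_unitInterval_ne_zero_top n
  refine (ENNReal.mul_right_inj h0 ht).1 ?_
  rw [← lintegral_radial_mul n measurable_indicator_Iio_one hh,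
    ← lintegral_radial_mul n measurable_indicator_Iio_one
      (show Measurable fun x => h (e x) by fun_prop),
    ← e.measurePreserving.lintegral_comp
      (f := fun x => (Iio (1 : ℝ)).indicator 1 ‖x‖ * h (‖x‖⁻¹ • x))
      (by have := measurable_indicator_Iio_one; fun_prop)]
  simp

/-! ### Normalized Gaussian vectors -/

theorem lintegral_fin_prod_eq_prod (m : ℕ) (f : Fin m → ℝ → ℝ≥0∞)
    (hf : ∀ i, Measurable (f i)) :
    ∫⁻ x : Fin m → ℝ, ∏ i, f i (x i) = ∏ i, ∫⁻ t, f i t := by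
  induction m with
  | zero => simp [volume_pi]
  | succ m ih =>
    have hm : Measurable fun x : Fin (m + 1) → ℝ => ∏ i, f i (x i) :=
      Finset.measurable_prod _ fun i _ => (hf i).comp (measurable_pi_apply i)
    have hm' : Measurable fun x : Fin m → ℝ => ∏ i, f i.succ (x i) :=
      Finset.measurable_prod _ fun i _ => (hf i.succ).comp (measurable_pi_apply i)
    rw [← (volume_preserving_piFinSuccAbove (fun _ => ℝ) 0).symm.lintegral_comp hm,
      Fin.prod_univ_succ, ← ih _ fun i => hf i.succ, Measure.volume_eq_prod,
      ← lintegral_prod_mul (hf 0).aemeasurable hm'.aemeasurable]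
    refine lintegral_congr fun p => ?_
    simp [Fin.prod_univ_succ, MeasurableEquiv.piFinSuccAbove]

theorem pi_gaussianReal_eq_withDensity (m : ℕ) :
    Measure.pi (fun _ : Fin m => gaussianReal 0 1) =
      (volume : Measure (Fin m → ℝ)).withDensity fun x => ∏ i, gaussianPDF 0 1 (x i) := by
  have hm : Measurable fun x : Fin m → ℝ => ∏ i, gaussianPDF 0 1 (x i) :=
    Finset.measurable_prod _ fun i _ => (measurable_gaussianPDF 0 1).comp (measurable_pi_apply i)
  refine Measure.pi_eq fun s hs => ?_
  rw [withDensity_apply _ (.univ_pi hs), ← lintegral_indicator (.univ_pi hs)]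
  have : ∀ x : Fin m → ℝ, (univ.pi s).indicator (fun x => ∏ i, gaussianPDF 0 1 (x i)) x =
      ∏ i, (s i).indicator (gaussianPDF 0 1) (x i) := by
    intro x
    by_cases hx : x ∈ univ.pi s
    · rw [indicator_of_mem hx]
      exact Finset.prod_congr rfl fun i _ => by rw [indicator_of_mem (hx i trivial)]
    · rw [indicator_of_notMem hx]
      obtain ⟨i, hi⟩ : ∃ i, x i ∉ s i := by simpa [mem_pi] using hx
      exact (Finset.prod_eq_zero (Finset.mem_univ i) (indicator_of_notMem hi _)).symm
  simp_rw [this]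
  rw [lintegral_fin_prod_eq_prod _ _ fun i => (measurable_gaussianPDF 0 1).indicator (hs i)]
  refine Finset.prod_congr rfl fun i _ => ?_
  rw [gaussianReal_of_var_ne_zero _ one_ne_zero, withDensity_apply _ (hs i),
    lintegral_indicator (hs i)]

theorem normalized_eq_smul {m : ℕ} (z : Fin m → ℝ) :
    normalized z = ‖WithLp.toLp 2 z‖⁻¹ • WithLp.toLp 2 z := by
  ext i
  simp [normalized, EuclideanSpace.norm_eq, div_eq_inv_mul]

@[fun_prop]
theorem measurable_normalized {m : ℕ} : Measurable (normalized (m := m)) := by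
  unfold normalized
  fun_prop

/-- The joint Gaussian density depends on the norm only, so the law of the direction is a multiple
of the surface measure. -/
theorem map_normalized_pi_gaussianReal (m : ℕ) :
    (Measure.pi fun _ : Fin (m + 1) => gaussianReal 0 1).map normalized =
      (surfaceMeasure (m + 1) univ)⁻¹ • surfaceMeasure (m + 1) := by
  set g : ℝ → ℝ≥0∞ := fun r => ENNReal.ofReal
    (((√(2 * Real.pi * 1))⁻¹) ^ (m + 1) * Real.exp (- r ^ 2 / 2)) with hg
  have hgm : Measurable g := by fun_prop
  set c := ∫⁻ r in Ioi (0 : ℝ), ENNReal.ofReal (r ^ m) * g r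
  have key : (Measure.pi fun _ : Fin (m + 1) => gaussianReal 0 1).map normalized =
      c • surfaceMeasure (m + 1) := by
    refine Measure.ext_of_lintegral _ fun h hh => ?_
    have hm : Measurable fun x : Fin (m + 1) → ℝ => ∏ i, gaussianPDF 0 1 (x i) :=
      Finset.measurable_prod _ fun i _ => (measurable_gaussianPDF 0 1).comp (measurable_pi_apply i)
    rw [lintegral_map hh measurable_normalized, pi_gaussianReal_eq_withDensity,
      lintegral_withDensity_eq_lintegral_mul _ hm (by fun_prop), lintegral_smul_measure,
      smul_eq_mul, ← lintegral_radial_mul m hgm hh,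
      ← (PiLp.volume_preserving_toLp (Fin (m + 1))).lintegral_comp (by fun_prop)]
    refine lintegral_congr fun z => ?_
    rw [Pi.mul_apply, normalized_eq_smul]
    congr 1
    simp only [gaussianPDF, gaussianPDFReal, hg]
    rw [← ENNReal.ofReal_prod_of_nonneg fun i _ => by positivity]
    congr 1
    rw [Finset.prod_mul_distrib, ← Real.exp_sum, EuclideanSpace.norm_sq_eq]
    simp [← Finset.sum_div]
  -- Total mass one determines `c`, so the radial Gaussian integral need not be evaluated.
  have h1 : c * surfaceMeasure (m + 1) univ = 1 := by
    have := congrArg (fun μ => μ univ) key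
    simp only [Measure.smul_apply, smul_eq_mul] at this
    rw [← this, Measure.map_apply measurable_normalized .univ]
    simp
  rw [key, ← ENNReal.eq_inv_of_mul_eq_one_left h1]

theorem IsStdNormalFamily.map_eq {Ω : Type*} [MeasurableSpace Ω] {P : Measure Ω}
    [IsProbabilityMeasure P] {m : ℕ} {Z : Fin m → Ω → ℝ} (h : IsStdNormalFamily P Z) :
    P.map (fun ω i => Z i ω) = Measure.pi fun _ => gaussianReal 0 1 := by
  rw [(iIndepFun_iff_map_fun_eq_pi_map fun i => (h.2 i).aemeasurable).1 h.1]
  simp_rw [(h.2 _).map_eq]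

theorem IsStdNormalFamily.aemeasurable {Ω : Type*} [MeasurableSpace Ω] {P : Measure Ω}
    {m : ℕ} {Z : Fin m → Ω → ℝ} (h : IsStdNormalFamily P Z) :
    AEMeasurable (fun ω i => Z i ω) P :=
  aemeasurable_pi_lambda _ fun i => (h.2 i).aemeasurable

theorem IsStdNormalFamily.map_normalized {Ω : Type*} [MeasurableSpace Ω] {P : Measure Ω}
    [IsProbabilityMeasure P] {m : ℕ} {Z : Fin (m + 1) → Ω → ℝ} (h : IsStdNormalFamily P Z) :
    P.map (fun ω => normalized fun i => Z i ω) =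
      (surfaceMeasure (m + 1) univ)⁻¹ • surfaceMeasure (m + 1) := by
  rw [← map_normalized_pi_gaussianReal, ← h.map_eq,
    AEMeasurable.map_map_of_aemeasurable measurable_normalized.aemeasurable h.aemeasurable]
  rfl

theorem surfaceMeasure_restrict_sphere (n : ℕ) :
    (surfaceMeasure n).restrict (Metric.sphere 0 1) = surfaceMeasure n := by
  refine Measure.restrict_eq_self_of_ae_mem ?_
  filter_upwards [ae_surfaceMeasure_norm n] with x hx
  simpa using hx

theorem cond_surfaceMeasure_sphere (n : ℕ) :
    cond (surfaceMeasure n) (Metric.sphere 0 1) =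
      (surfaceMeasure n univ)⁻¹ • surfaceMeasure n := by
  rw [ProbabilityTheory.cond, surfaceMeasure_restrict_sphere]
  congr 2
  rw [← Measure.restrict_apply_univ, surfaceMeasure_restrict_sphere]

/-! ### The solid angle fraction -/

/-- The reduction formula for powers of `sin` lowers the exponent by two and matches the recursion
of `Γ`, hence the two-step induction; its boundary terms vanish at `0` and `π`. -/
theorem integral_sin_pow_eq_beta (d : ℕ) :
    ∫ t in (0 : ℝ)..Real.pi, Real.sin t ^ d = beta (((d : ℝ) + 1) / 2) (1 / 2) := by
  induction d using Nat.twoStepInduction with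
  | zero =>
    simp only [pow_zero, integral_one, sub_zero, beta, Nat.cast_zero, zero_add, add_halves,
      Real.Gamma_one, div_one, Real.Gamma_one_half_eq]
    exact (Real.mul_self_sqrt Real.pi_pos.le).symm
  | one =>
    have h : Real.Gamma ((1 : ℝ) + 1 / 2) = 1 / 2 * √Real.pi := by
      rw [add_comm, Real.Gamma_add_one (by norm_num), Real.Gamma_one_half_eq]
    have : (((1 : ℕ) : ℝ) + 1) / 2 = 1 := by norm_num
    rw [this, beta, h, Real.Gamma_one, Real.Gamma_one_half_eq]
    have : √Real.pi ≠ 0 := (Real.sqrt_pos.2 Real.pi_pos).ne'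
    field_simp
    simp
    norm_num
  | more d ih _ =>
    rw [integral_sin_pow, ih, beta, beta]
    have h1 : (((d + 2 : ℕ) : ℝ) + 1) / 2 = ((d : ℝ) + 1) / 2 + 1 := by push_cast; ring
    have h2 : ((d : ℝ) + 1) / 2 + 1 + 1 / 2 = (((d : ℝ) + 1) / 2 + 1 / 2) + 1 := by ring
    have h3 : Real.Gamma (((d : ℝ) + 1) / 2 + 1 / 2) ≠ 0 :=
      (Real.Gamma_pos_of_pos (by positivity)).ne'
    rw [h1, h2, Real.Gamma_add_one (by positivity), Real.Gamma_add_one (by positivity)]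
    have h4 : ((d : ℝ) + 1) / 2 + 1 / 2 ≠ 0 := by positivity
    simp only [Real.sin_zero, Real.sin_pi]
    field_simp
    ring

theorem beta_half_pos (d : ℕ) : 0 < beta (((d : ℝ) + 1) / 2) (1 / 2) :=
  beta_pos (by positivity) (by norm_num)

theorem solidFrac_mul_beta (d : ℕ) (θ : ℝ) :
    solidFrac d θ * beta (((d : ℝ) + 1) / 2) (1 / 2) = ∫ t in (0 : ℝ)..θ, Real.sin t ^ d :=
  div_mul_cancel₀ _ (beta_half_pos d).ne'

theorem hasDerivAt_solidFrac (d : ℕ) (θ : ℝ) :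
    HasDerivAt (solidFrac d) (Real.sin θ ^ d / beta (((d : ℝ) + 1) / 2) (1 / 2)) θ := by
  have hc : Continuous fun t => Real.sin t ^ d := by fun_prop
  exact (intervalIntegral.integral_hasDerivAt_right (hc.intervalIntegrable _ _)
    (hc.stronglyMeasurableAtFilter _ _) hc.continuousAt).div_const _

theorem continuous_solidFrac (d : ℕ) : Continuous (solidFrac d) :=
  continuous_iff_continuousAt.2 fun θ => (hasDerivAt_solidFrac d θ).continuousAt

@[simp]
theorem solidFrac_zero (d : ℕ) : solidFrac d 0 = 0 := by simp [solidFrac]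

@[simp]
theorem solidFrac_pi (d : ℕ) : solidFrac d Real.pi = 1 := by
  rw [solidFrac, integral_sin_pow_eq_beta, div_self (beta_half_pos d).ne']

theorem strictMonoOn_solidFrac (d : ℕ) : StrictMonoOn (solidFrac d) (Icc 0 Real.pi) := by
  refine strictMonoOn_of_deriv_pos (convex_Icc _ _) (continuous_solidFrac d).continuousOn ?_
  intro x hx
  rw [interior_Icc] at hx
  rw [(hasDerivAt_solidFrac d x).deriv]
  exact div_pos (pow_pos (Real.sin_pos_of_mem_Ioo hx) d) (beta_half_pos d)

theorem bijOn_solidFrac (d : ℕ) : BijOn (solidFrac d) (Icc 0 Real.pi) (Icc 0 1) := by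
  refine ⟨fun x hx => ⟨?_, ?_⟩, (strictMonoOn_solidFrac d).injOn, ?_⟩
  · rw [← solidFrac_zero d]
    exact (strictMonoOn_solidFrac d).monotoneOn (left_mem_Icc.2 Real.pi_pos.le) hx hx.1
  · rw [← solidFrac_pi d]
    exact (strictMonoOn_solidFrac d).monotoneOn hx (right_mem_Icc.2 Real.pi_pos.le) hx.2
  · have := intermediate_value_Icc Real.pi_pos.le (continuous_solidFrac d).continuousOn
    rwa [solidFrac_zero, solidFrac_pi] at this

theorem invOn_solidFracInv (d : ℕ) :
    InvOn (solidFracInv d) (solidFrac d) (Icc 0 Real.pi) (Icc 0 1) :=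
  (bijOn_solidFrac d).invOn_invFunOn

theorem solidFracInv_mem (d : ℕ) {u : ℝ} (hu : u ∈ Icc (0 : ℝ) 1) :
    solidFracInv d u ∈ Icc 0 Real.pi :=
  (bijOn_solidFrac d).surjOn.mapsTo_invFunOn hu

theorem solidFrac_solidFracInv (d : ℕ) {u : ℝ} (hu : u ∈ Icc (0 : ℝ) 1) :
    solidFrac d (solidFracInv d u) = u :=
  (invOn_solidFracInv d).2 hu

theorem solidFracInv_le_iff (d : ℕ) {u θ : ℝ} (hu : u ∈ Icc (0 : ℝ) 1) (hθ : θ ∈ Icc 0 Real.pi) :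
    solidFracInv d u ≤ θ ↔ u ≤ solidFrac d θ := by
  rw [← (strictMonoOn_solidFrac d).le_iff_le (solidFracInv_mem d hu) hθ,
    solidFrac_solidFracInv d hu]

theorem solidFracInv_strictMonoOn (d : ℕ) : StrictMonoOn (solidFracInv d) (Icc 0 1) := by
  intro u hu v hv huv
  rw [← (strictMonoOn_solidFrac d).lt_iff_lt (solidFracInv_mem d hu) (solidFracInv_mem d hv),
    solidFrac_solidFracInv d hu, solidFrac_solidFracInv d hv]
  exact huv

theorem solidFracInv_zero (d : ℕ) : solidFracInv d 0 = 0 := by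
  simpa using (invOn_solidFracInv d).1 (left_mem_Icc.2 Real.pi_pos.le)

@[fun_prop]
-- Monotone on `[0, 1]`; outside, no preimage exists and `invFunOn` returns one fixed default value.
theorem measurable_solidFracInv (d : ℕ) : Measurable (solidFracInv d) := by
  refine measurable_of_restrict_of_restrict_compl measurableSet_Icc (s := Icc (0 : ℝ) 1) ?_ ?_
  · have : Monotone ((Icc (0 : ℝ) 1).domRestrict (solidFracInv d)) := fun x y hxy =>
      (solidFracInv_strictMonoOn d).monotoneOn x.2 y.2 hxy
    exact this.measurable
  · refine measurable_const' fun x y => ?_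
    have hx : ∀ x : ((Icc (0 : ℝ) 1)ᶜ : Set ℝ), ¬ ∃ a ∈ Icc 0 Real.pi, solidFrac d a = x.1 :=
      fun x ⟨a, ha, hax⟩ => x.2 (hax ▸ (bijOn_solidFrac d).mapsTo ha)
    simp only [domRestrict_apply, solidFracInv]
    rw [Function.invFunOn, Function.invFunOn, dif_neg (hx x), dif_neg (hx y)]

/-! ### Laws of the planar angle -/

theorem sinPowMeasure_Icc (d : ℕ) {a b : ℝ} (ha : 0 ≤ a) (hab : a ≤ b) (hb : b ≤ Real.pi) :
    sinPowMeasure d (Icc a b) =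
      ENNReal.ofReal (beta (((d : ℝ) + 1) / 2) (1 / 2) * (solidFrac d b - solidFrac d a)) := by
  have hc : Continuous fun t => Real.sin t ^ d := by fun_prop
  rw [sinPowMeasure, withDensity_apply _ measurableSet_Icc, Measure.restrict_restrict
    measurableSet_Icc, inter_eq_left.2 (Icc_subset_Icc ha hb), mul_sub, mul_comm, mul_comm _
    (solidFrac d a), solidFrac_mul_beta, solidFrac_mul_beta,
    intervalIntegral.integral_interval_sub_left (hc.intervalIntegrable _ _)
      (hc.intervalIntegrable _ _), intervalIntegral.integral_of_le hab,
    ← integral_Icc_eq_integral_Ioc,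
    ofReal_integral_eq_lintegral_ofReal hc.integrableOn_Icc]
  filter_upwards [ae_restrict_mem measurableSet_Icc] with t ht
  exact pow_nonneg (Real.sin_nonneg_of_mem_Icc ⟨ha.trans ht.1, ht.2.trans hb⟩) d

theorem ae_sinPowMeasure_mem (d : ℕ) : ∀ᵐ θ ∂sinPowMeasure d, θ ∈ Icc 0 Real.pi :=
  (withDensity_absolutelyContinuous _ _).ae_le (ae_restrict_mem measurableSet_Icc)

theorem sinPowMeasure_Iic (d : ℕ) {θ : ℝ} (hθ : θ ∈ Icc 0 Real.pi) :
    sinPowMeasure d (Iic θ) =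
      ENNReal.ofReal (beta (((d : ℝ) + 1) / 2) (1 / 2) * solidFrac d θ) := by
  have : Iic θ =ᵐ[sinPowMeasure d] Icc 0 θ := by
    filter_upwards [ae_sinPowMeasure_mem d] with t ht
    exact propext ⟨fun h => ⟨ht.1, h⟩, fun h => h.2⟩
  rw [measure_congr this, sinPowMeasure_Icc d le_rfl hθ.1 hθ.2, solidFrac_zero, sub_zero]

theorem ofReal_beta_half_ne_zero (d : ℕ) :
    ENNReal.ofReal (beta (((d : ℝ) + 1) / 2) (1 / 2)) ≠ 0 := by
  simpa using beta_half_pos d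

/-- Equality of distribution functions: for `θ ∈ [0, π]`, `Θ⁻¹ u ≤ θ` means `u ≤ Θ θ`. Below `0`
both functions vanish, and above `π` both are constant. -/
theorem map_solidFracInv_unitInterval (d : ℕ) :
    ((volume : Measure ℝ).restrict (Icc 0 1)).map (solidFracInv d) =
      (ENNReal.ofReal (beta (((d : ℝ) + 1) / 2) (1 / 2)))⁻¹ • sinPowMeasure d := by
  have hβ := ofReal_beta_half_ne_zero d
  refine Measure.ext_of_Iic _ _ fun θ => ?_
  rw [Measure.map_apply (measurable_solidFracInv d) measurableSet_Iic,
    Measure.restrict_apply (measurable_solidFracInv d measurableSet_Iic), Measure.smul_apply,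
    smul_eq_mul]
  have hmid : ∀ θ ∈ Icc 0 Real.pi, volume (solidFracInv d ⁻¹' Iic θ ∩ Icc 0 1) =
      (ENNReal.ofReal (beta (((d : ℝ) + 1) / 2) (1 / 2)))⁻¹ * sinPowMeasure d (Iic θ) := by
    intro θ hθ
    have hΘ := (bijOn_solidFrac d).mapsTo hθ
    have : solidFracInv d ⁻¹' Iic θ ∩ Icc 0 1 = Icc 0 (solidFrac d θ) := by
      ext u
      constructor
      · rintro ⟨h, hu⟩
        exact ⟨hu.1, (solidFracInv_le_iff d hu hθ).1 h⟩
      · intro hu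
        have hu' : u ∈ Icc (0 : ℝ) 1 := ⟨hu.1, hu.2.trans hΘ.2⟩
        exact ⟨(solidFracInv_le_iff d hu' hθ).2 hu.2, hu'⟩
    rw [this, Real.volume_Icc, sub_zero, sinPowMeasure_Iic d hθ,
      ENNReal.ofReal_mul (beta_half_pos d).le, ← mul_assoc,
      ENNReal.inv_mul_cancel hβ ENNReal.ofReal_ne_top, one_mul]
  rcases lt_or_ge θ 0 with h0 | h0
  · have h1 : solidFracInv d ⁻¹' Iic θ ∩ Icc 0 1 = ∅ := by
      ext u
      simp only [mem_inter_iff, mem_preimage, mem_Iic, mem_empty_iff_false, iff_false, not_and]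
      exact fun h hu => absurd ((solidFracInv_mem d hu).1.trans h) (not_le.2 h0)
    have h2 : sinPowMeasure d (Iic θ) = 0 := by
      refine measure_mono_null ?_ (ae_iff.1 (ae_sinPowMeasure_mem d))
      exact fun t ht h => absurd (h.1.trans ht) (not_le.2 h0)
    rw [h1, h2, measure_empty, mul_zero]
  rcases le_or_gt θ Real.pi with h1 | h1
  · exact hmid θ ⟨h0, h1⟩
  · have h2 : solidFracInv d ⁻¹' Iic θ ∩ Icc 0 1 = solidFracInv d ⁻¹' Iic Real.pi ∩ Icc 0 1 := by
      ext u
      constructor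
      · exact fun h => ⟨(solidFracInv_mem d h.2).2, h.2⟩
      · exact fun h => ⟨h.1.trans h1.le, h.2⟩
    have h3 : Iic θ =ᵐ[sinPowMeasure d] Iic Real.pi := by
      filter_upwards [ae_sinPowMeasure_mem d] with t ht
      exact propext ⟨fun _ => ht.2, fun _ => ht.2.trans h1.le⟩
    rw [h2, measure_congr h3]
    exact hmid _ (right_mem_Icc.2 Real.pi_pos.le)

/-- Restriction of the previous identity, since `Θ⁻¹` is increasing. The case `Ω₁ = 0` serves the
cap, the general case the hollow cone. -/
theorem map_solidFracInv_Icc (d : ℕ) {Ω₁ Ω₂ : ℝ} (h0 : 0 ≤ Ω₁) (h12 : Ω₁ ≤ Ω₂) (h1 : Ω₂ ≤ 1) :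
    ((volume : Measure ℝ).restrict (Icc Ω₁ Ω₂)).map (solidFracInv d) =
      (ENNReal.ofReal (beta (((d : ℝ) + 1) / 2) (1 / 2)))⁻¹ •
        (sinPowMeasure d).restrict (Icc (solidFracInv d Ω₁) (solidFracInv d Ω₂)) := by
  rw [← Measure.restrict_smul, ← map_solidFracInv_unitInterval,
    Measure.restrict_map (measurable_solidFracInv d) measurableSet_Icc,
    Measure.restrict_restrict (measurable_solidFracInv d measurableSet_Icc)]
  congr 2
  have hm := solidFracInv_strictMonoOn d
  have hΩ₁ : Ω₁ ∈ Icc (0 : ℝ) 1 := ⟨h0, h12.trans h1⟩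
  have hΩ₂ : Ω₂ ∈ Icc (0 : ℝ) 1 := ⟨h0.trans h12, h1⟩
  ext u
  constructor
  · intro hu
    have hu' : u ∈ Icc (0 : ℝ) 1 := ⟨h0.trans hu.1, hu.2.trans h1⟩
    exact ⟨⟨hm.monotoneOn hΩ₁ hu' hu.1, hm.monotoneOn hu' hΩ₂ hu.2⟩, hu'⟩
  · rintro ⟨⟨ha, hb⟩, hu⟩
    exact ⟨(hm.le_iff_le hΩ₁ hu).1 ha, (hm.le_iff_le hu hΩ₂).1 hb⟩

/-- Proportional measures with total mass one are the normalization of each other. -/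
theorem eq_cond_of_eq_smul {α : Type*} [MeasurableSpace α] {ν μ : Measure α}
    [IsProbabilityMeasure ν] {s : Set α} {c : ℝ≥0∞} (h : ν = c • μ.restrict s) :
    ν = ProbabilityTheory.cond μ s := by
  have h1 : c * μ s = 1 := by
    rw [← Measure.restrict_apply_univ, ← smul_eq_mul, ← Measure.smul_apply, ← h, measure_univ]
  rw [h, ENNReal.eq_inv_of_mul_eq_one_left h1]
  rfl

theorem aemeasurable_of_isUniform_Icc {Ω : Type*} [MeasurableSpace Ω] {P : Measure Ω}
    {a b : ℝ} (hab : a < b) {U : Ω → ℝ} (hU : pdf.IsUniform U (Icc a b) P) :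
    AEMeasurable U P :=
  hU.aemeasurable (by simpa using hab) (by simp)

theorem map_solidFracInv_of_isUniform (d : ℕ) {Ω₁ Ω₂ : ℝ} (h0 : 0 ≤ Ω₁) (h12 : Ω₁ < Ω₂)
    (h1 : Ω₂ ≤ 1) {Ω : Type*} [MeasurableSpace Ω] {P : Measure Ω} [IsProbabilityMeasure P]
    {U : Ω → ℝ} (hU : pdf.IsUniform U (Icc Ω₁ Ω₂) P) :
    P.map (fun ω => solidFracInv d (U ω)) =
      cond (sinPowMeasure d) (Icc (solidFracInv d Ω₁) (solidFracInv d Ω₂)) := by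
  have hUm := aemeasurable_of_isUniform_Icc h12 hU
  have : IsProbabilityMeasure (P.map fun ω => solidFracInv d (U ω)) :=
    Measure.isProbabilityMeasure_map (by fun_prop)
  have key : P.map (fun ω => solidFracInv d (U ω)) = (P.map U).map (solidFracInv d) :=
    (AEMeasurable.map_map_of_aemeasurable (measurable_solidFracInv d).aemeasurable hUm).symm
  refine eq_cond_of_eq_smul (c := (volume (Icc Ω₁ Ω₂))⁻¹ *
    (ENNReal.ofReal (beta (((d : ℝ) + 1) / 2) (1 / 2)))⁻¹) ?_
  rw [key, hU, ProbabilityTheory.cond, Measure.map_smul,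
    map_solidFracInv_Icc d h0 h12.le h1, smul_smul]

/-- By `Γ(1/2) = √π`. This identifies the constant of `angleDensity` with `1 / (B Θ(θ₀))`, the
normalization of `sin ^ d` on `[0, θ₀]`. -/
theorem sphereArea_mul_beta (d : ℕ) :
    sphereArea (d + 1) * beta (((d : ℝ) + 1) / 2) (1 / 2) = sphereArea (d + 2) := by
  have h1 : ((d : ℝ) + 1) / 2 + 1 / 2 = ((d + 2 : ℕ) : ℝ) / 2 := by push_cast; ring
  have h2 : ((d : ℝ) + 1) / 2 = ((d + 1 : ℕ) : ℝ) / 2 := by push_cast; ring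
  have h3 : ((d + 2 : ℕ) : ℝ) / 2 = ((d + 1 : ℕ) : ℝ) / 2 + 1 / 2 := by push_cast; ring
  have hG : Real.Gamma (((d + 1 : ℕ) : ℝ) / 2) ≠ 0 := (Real.Gamma_pos_of_pos (by positivity)).ne'
  rw [beta, h1, sphereArea, sphereArea, h2, Real.Gamma_one_half_eq, Real.sqrt_eq_rpow]
  conv_rhs => rw [h3, Real.rpow_add Real.pi_pos, ← h3]
  field_simp

theorem solidFrac_pos (d : ℕ) {θ : ℝ} (h0 : 0 < θ) (hπ : θ ≤ Real.pi) : 0 < solidFrac d θ := by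
  rw [← solidFrac_zero d]
  exact strictMonoOn_solidFrac d (left_mem_Icc.2 Real.pi_pos.le) ⟨h0.le, hπ⟩ h0

theorem sinPowMeasure_Icc_ne_zero (d : ℕ) {a b : ℝ} (ha : 0 ≤ a) (hab : a < b)
    (hb : b ≤ Real.pi) : sinPowMeasure d (Icc a b) ≠ 0 := by
  rw [sinPowMeasure_Icc d ha hab.le hb]
  simpa using mul_pos (beta_half_pos d) (sub_pos.2 <|
    strictMonoOn_solidFrac d ⟨ha, hab.le.trans hb⟩ ⟨ha.trans hab.le, hb⟩ hab)

theorem angleLaw_eq_cond (d : ℕ) {θ₀ : ℝ} (h0 : 0 < θ₀) (hπ : θ₀ ≤ Real.pi) :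
    angleLaw d θ₀ = cond (sinPowMeasure d) (Icc 0 θ₀) := by
  have hΘ := solidFrac_pos d h0 hπ
  have hβ := beta_half_pos d
  have hs := sphereArea_pos d
  have hc : sphereArea (d + 1) / (sphereArea (d + 2) * solidFrac d θ₀) =
      (beta (((d : ℝ) + 1) / 2) (1 / 2) * solidFrac d θ₀)⁻¹ := by
    rw [← sphereArea_mul_beta]
    field_simp
  have : (fun θ => ENNReal.ofReal (angleDensity d θ₀ θ)) = (Icc 0 θ₀).indicator
      ((ENNReal.ofReal (beta (((d : ℝ) + 1) / 2) (1 / 2) * solidFrac d θ₀))⁻¹ •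
        fun t => ENNReal.ofReal (Real.sin t ^ d)) := by
    ext θ
    by_cases h : θ ∈ Icc 0 θ₀
    · simp only [angleDensity, indicator_of_mem h, Pi.smul_apply, smul_eq_mul]
      rw [hc, ENNReal.ofReal_mul (by positivity), ENNReal.ofReal_inv_of_pos (by positivity)]
    · simp [angleDensity, indicator_of_notMem h]
  rw [angleLaw, this, withDensity_indicator measurableSet_Icc, withDensity_smul _ (by fun_prop),
    ProbabilityTheory.cond, sinPowMeasure_Icc d le_rfl h0.le hπ, solidFrac_zero, sub_zero,
    sinPowMeasure, restrict_withDensity measurableSet_Icc,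
    Measure.restrict_restrict measurableSet_Icc, inter_eq_left.2 (Icc_subset_Icc le_rfl hπ)]

theorem isProbabilityMeasure_angleLaw (d : ℕ) {θ₀ : ℝ} (h0 : 0 < θ₀) (hπ : θ₀ ≤ Real.pi) :
    IsProbabilityMeasure (angleLaw d θ₀) := by
  rw [angleLaw_eq_cond d h0 hπ]
  exact cond_isProbabilityMeasure (sinPowMeasure_Icc_ne_zero d le_rfl h0 hπ)

theorem angleLaw_Iic (d : ℕ) {θ₀ : ℝ} (h0 : 0 < θ₀) (hπ : θ₀ ≤ Real.pi) {θ : ℝ} (hθ : 0 ≤ θ) :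
    angleLaw d θ₀ (Iic θ) =
      ENNReal.ofReal (if θ ≤ θ₀ then solidFrac d θ / solidFrac d θ₀ else 1) := by
  have hΘ := solidFrac_pos d h0 hπ
  have hβ := beta_half_pos d
  have hmin : Icc 0 θ₀ ∩ Iic θ = Icc 0 (min θ₀ θ) := by
    ext x; simp [and_assoc]
  rw [angleLaw_eq_cond d h0 hπ, cond_apply measurableSet_Icc, hmin,
    sinPowMeasure_Icc d le_rfl h0.le hπ, sinPowMeasure_Icc d le_rfl (le_min h0.le hθ)
      ((min_le_left _ _).trans hπ), solidFrac_zero, sub_zero, sub_zero,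
    ← ENNReal.ofReal_inv_of_pos (by positivity), ← ENNReal.ofReal_mul (by positivity)]
  congr 1
  split_ifs with h
  · rw [min_eq_right h]
    field_simp
  · rw [min_eq_left (not_le.1 h).le]
    field_simp

theorem hasLaw_solidFracInv (d : ℕ) {θ₀ : ℝ} (h0 : 0 < θ₀) (hπ : θ₀ ≤ Real.pi)
    {Ω : Type*} [MeasurableSpace Ω] {P : Measure Ω} [IsProbabilityMeasure P]
    {U : Ω → ℝ} (hU : pdf.IsUniform U (Icc 0 (solidFrac d θ₀)) P) :
    HasLaw (fun ω => solidFracInv d (U ω)) (angleLaw d θ₀) P := by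
  have hΘ := solidFrac_pos d h0 hπ
  have hUm := aemeasurable_of_isUniform_Icc hΘ hU
  refine ⟨by fun_prop, ?_⟩
  have hmem : θ₀ ∈ Icc 0 Real.pi := ⟨h0.le, hπ⟩
  rw [map_solidFracInv_of_isUniform d le_rfl hΘ ((bijOn_solidFrac d).mapsTo hmem).2 hU,
    solidFracInv_zero, (invOn_solidFracInv d).1 hmem, angleLaw_eq_cond d h0 hπ]

/-! ### Caps and hollow cones about the last axis -/

theorem inner_axis {d : ℕ} (x : EuclideanSpace ℝ (Fin (d + 2))) :
    inner ℝ x (axis d) = x (Fin.last (d + 1)) := by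
  simp [axis, EuclideanSpace.inner_single_right]

theorem norm_axis (d : ℕ) : ‖axis d‖ = 1 := by simp [axis]

theorem capPoint_eq_polarPoint {d : ℕ} (θ : ℝ) (z : Fin (d + 1) → ℝ) :
    capPoint θ z = polarPoint (θ, normalized z) := by
  ext i
  refine Fin.lastCases ?_ (fun i => ?_) i
  · simp [capPoint, polarPoint, axis]
  · simp [capPoint, polarPoint, axis, Pi.single_apply]

theorem measurableSet_hollowCone {d : ℕ} (μ : EuclideanSpace ℝ (Fin (d + 2))) (a b : ℝ) :
    MeasurableSet (hollowCone μ a b) := by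
  have h1 : IsClosed {x : EuclideanSpace ℝ (Fin (d + 2)) | ‖x‖ = 1} :=
    isClosed_eq (by fun_prop) (by fun_prop)
  have h2 : IsClosed {x : EuclideanSpace ℝ (Fin (d + 2)) | inner ℝ x μ ≤ Real.cos a} :=
    isClosed_le (by fun_prop) (by fun_prop)
  have h3 : IsClosed {x : EuclideanSpace ℝ (Fin (d + 2)) | Real.cos b ≤ inner ℝ x μ} :=
    isClosed_le (by fun_prop) (by fun_prop)
  exact (h1.inter (h2.inter h3)).measurableSet

/-- The extra inequality is Cauchy–Schwarz. Caps and hollow cones can thus share their proofs. -/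
theorem cap_eq_hollowCone {d : ℕ} {μ : EuclideanSpace ℝ (Fin (d + 2))} (hμ : ‖μ‖ = 1) (θ : ℝ) :
    cap μ θ = hollowCone μ 0 θ := by
  ext x
  simp only [cap, hollowCone, Real.cos_zero, mem_ofPred_eq]
  refine ⟨fun h => ⟨h.1, ?_, h.2⟩, fun h => ⟨h.1, h.2.2⟩⟩
  simpa [h.1, hμ] using real_inner_le_norm x μ

theorem polarPoint_mem_hollowCone_axis_iff {d : ℕ} {a b θ : ℝ}
    {s : EuclideanSpace ℝ (Fin (d + 1))} (hs : ‖s‖ = 1) (ha : a ∈ Icc 0 Real.pi)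
    (hb : b ∈ Icc 0 Real.pi) (hθ : θ ∈ Icc 0 Real.pi) :
    polarPoint (θ, s) ∈ hollowCone (axis d) a b ↔ θ ∈ Icc a b := by
  have h : inner ℝ (polarPoint (θ, s)) (axis d) = Real.cos θ := by
    rw [inner_axis, polarPoint, appendCoord_last]
  simp only [hollowCone, mem_ofPred_eq, h, norm_polarPoint θ hs, true_and,
    Real.strictAntiOn_cos.le_iff_ge hθ ha, Real.strictAntiOn_cos.le_iff_ge hb hθ, mem_Icc]

/-- As `cos` is strictly decreasing on `[0, π]`, the cone pulls back, up to a null set, to a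
rectangle, and restricting a product measure to it restricts the first factor. -/
theorem surfaceMeasure_restrict_hollowCone_axis (d : ℕ) {a b : ℝ} (ha : a ∈ Icc 0 Real.pi)
    (hb : b ∈ Icc 0 Real.pi) :
    (surfaceMeasure (d + 2)).restrict (hollowCone (axis d) a b) =
      (((sinPowMeasure d).restrict (Icc a b)).prod (surfaceMeasure (d + 1))).map polarPoint := by
  rw [surfaceMeasure_eq_map_polarPoint, Measure.restrict_map measurable_polarPoint
    (measurableSet_hollowCone _ _ _)]
  congr 1
  have : polarPoint ⁻¹' hollowCone (axis d) a b =ᵐ[(sinPowMeasure d).prod (surfaceMeasure (d + 1))]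
      (Icc a b ×ˢ (univ : Set (EuclideanSpace ℝ (Fin (d + 1))))) := by
    filter_upwards [Measure.quasiMeasurePreserving_fst.ae (ae_sinPowMeasure_mem d),
      Measure.quasiMeasurePreserving_snd.ae (ae_surfaceMeasure_norm (d + 1))] with p h1 h2
    exact propext <| (polarPoint_mem_hollowCone_axis_iff h2 ha hb h1).trans
      ⟨fun h => ⟨h, trivial⟩, fun h => h.1⟩
  rw [Measure.restrict_congr_set this, ← Measure.prod_restrict, Measure.restrict_univ]

theorem surfaceMeasure_cap_axis (d : ℕ) {θ : ℝ} (hθ : θ ∈ Icc 0 Real.pi) :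
    surfaceMeasure (d + 2) (cap (axis d) θ) =
      ENNReal.ofReal (sphereArea (d + 2) * solidFrac d θ) := by
  rw [cap_eq_hollowCone (norm_axis d), ← Measure.restrict_apply_univ,
    surfaceMeasure_restrict_hollowCone_axis d (left_mem_Icc.2 Real.pi_pos.le) hθ,
    Measure.map_apply measurable_polarPoint .univ, preimage_univ, ← univ_prod_univ,
    Measure.prod_prod, Measure.restrict_apply_univ, surfaceMeasure_univ,
    sinPowMeasure_Icc d le_rfl hθ.1 hθ.2, ← ENNReal.ofReal_mul' (sphereArea_pos d).le,
    solidFrac_zero, sub_zero, ← sphereArea_mul_beta]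
  congr 1
  ring

/-- Independence makes the joint law of angle and direction a product, whose image under
`polarPoint` is proportional to the surface measure restricted to the cone. -/
theorem isUniform_capPoint (d : ℕ) {a b : ℝ} (ha : 0 ≤ a) (hab : a ≤ b) (hb : b ≤ Real.pi)
    {Ω : Type*} [MeasurableSpace Ω] {P : Measure Ω} [IsProbabilityMeasure P]
    {θ : Ω → ℝ} {Z : Fin (d + 1) → Ω → ℝ} (hθ : AEMeasurable θ P)
    (hmap : P.map θ = cond (sinPowMeasure d) (Icc a b)) (hZ : IsStdNormalFamily P Z)
    (hind : IndepFun θ (fun ω i => Z i ω) P) :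
    pdf.IsUniform (fun ω => capPoint (θ ω) fun i => Z i ω) (hollowCone (axis d) a b) P
      (surfaceMeasure (d + 2)) := by
  have hZm := hZ.aemeasurable
  have hS : AEMeasurable (fun ω => normalized fun i => Z i ω) P :=
    measurable_normalized.comp_aemeasurable hZm
  have hind' : IndepFun θ (fun ω => normalized fun i => Z i ω) P :=
    hind.comp measurable_id measurable_normalized
  have hpair := (indepFun_iff_map_prod_eq_prod_map_map hθ hS).1 hind'
  have hX : AEMeasurable (fun ω => capPoint (θ ω) fun i => Z i ω) P := by
    simp_rw [capPoint_eq_polarPoint]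
    exact measurable_polarPoint.comp_aemeasurable (hθ.prodMk hS)
  have : IsProbabilityMeasure (P.map fun ω => capPoint (θ ω) fun i => Z i ω) :=
    Measure.isProbabilityMeasure_map hX
  refine eq_cond_of_eq_smul (c := (surfaceMeasure (d + 1) univ)⁻¹ *
    (sinPowMeasure d (Icc a b))⁻¹) ?_
  simp_rw [capPoint_eq_polarPoint]
  rw [surfaceMeasure_restrict_hollowCone_axis d ⟨ha, hab.trans hb⟩ ⟨ha.trans hab, hb⟩,
    ← Measure.map_smul, ← smul_smul, ← Measure.prod_smul_left, ← Measure.prod_smul_right]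
  have := AEMeasurable.map_map_of_aemeasurable (g := polarPoint)
    measurable_polarPoint.aemeasurable (hθ.prodMk hS)
  rw [hpair, hmap, hZ.map_normalized] at this
  exact this.symm

/-! ### The rotation -/

section Rotation

variable {d : ℕ} (μ : EuclideanSpace ℝ (Fin (d + 2)))

theorem rotate_ofLp (x : EuclideanSpace ℝ (Fin (d + 2))) :
    (rotate μ x).ofLp = rotationMatrix μ *ᵥ x.ofLp := by
  simp only [rotate, rotationMatrix, Matrix.add_mulVec, Matrix.one_mulVec, Matrix.mulVec_mulVec,
    Matrix.mul_assoc]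

/-- The unit vector in the plane of `μ` and the axis, orthogonal to the axis. -/
noncomputable def planeNormal : EuclideanSpace ℝ (Fin (d + 2)) :=
  ‖μ - μ (Fin.last (d + 1)) • axis d‖⁻¹ • (μ - μ (Fin.last (d + 1)) • axis d)

theorem norm_sub_smul_axis_sq {μ : EuclideanSpace ℝ (Fin (d + 2))} (hμ : ‖μ‖ = 1) :
    ‖μ - μ (Fin.last (d + 1)) • axis d‖ ^ 2 = 1 - μ (Fin.last (d + 1)) ^ 2 := by
  rw [norm_sub_sq_real, hμ, inner_smul_right, inner_axis, norm_smul, norm_axis, mul_one,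
    Real.norm_eq_abs, sq_abs]
  ring

theorem norm_sub_smul_axis {μ : EuclideanSpace ℝ (Fin (d + 2))} (hμ : ‖μ‖ = 1) :
    ‖μ - μ (Fin.last (d + 1)) • axis d‖ = √(1 - μ (Fin.last (d + 1)) ^ 2) := by
  rw [← norm_sub_smul_axis_sq hμ, Real.sqrt_sq (norm_nonneg _)]

theorem inner_planeNormal_axis : inner ℝ (planeNormal μ) (axis d) = 0 := by
  rw [inner_axis]
  simp [planeNormal, axis]

theorem eq_smul_axis_add_smul_planeNormal {μ : EuclideanSpace ℝ (Fin (d + 2))} (hμ : ‖μ‖ = 1) :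
    μ = μ (Fin.last (d + 1)) • axis d + √(1 - μ (Fin.last (d + 1)) ^ 2) • planeNormal μ := by
  rw [← norm_sub_smul_axis hμ, planeNormal, smul_smul]
  by_cases h : μ - μ (Fin.last (d + 1)) • axis d = 0
  · rw [h, smul_zero, add_zero]
    exact sub_eq_zero.1 h
  · rw [mul_inv_cancel₀ (norm_ne_zero_iff.2 h), one_smul, add_sub_cancel]

/-- If `μ = ±eₙ`, the normal vector is zero, but its coefficient `√(1 - μₙ²)` vanishes as well, so
formulas in the plane survive. -/
theorem planeNormal_cases {μ : EuclideanSpace ℝ (Fin (d + 2))} (hμ : ‖μ‖ = 1) :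
    ‖planeNormal μ‖ = 1 ∨ planeNormal μ = 0 ∧ √(1 - μ (Fin.last (d + 1)) ^ 2) = 0 := by
  by_cases h : μ - μ (Fin.last (d + 1)) • axis d = 0
  · refine .inr ⟨by simp [planeNormal, h], ?_⟩
    rw [← norm_sub_smul_axis hμ, h, norm_zero]
  · left
    rw [planeNormal, norm_smul, norm_inv, norm_norm, inv_mul_cancel₀ (norm_ne_zero_iff.2 h)]

theorem last_sq_le_one {μ : EuclideanSpace ℝ (Fin (d + 2))} (hμ : ‖μ‖ = 1) :
    0 ≤ 1 - μ (Fin.last (d + 1)) ^ 2 := by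
  rw [← norm_sub_smul_axis_sq hμ]; positivity

theorem planeBasis_transpose_mulVec (x : EuclideanSpace ℝ (Fin (d + 2))) :
    (planeBasis μ)ᵀ *ᵥ x.ofLp = ![inner ℝ x (axis d), inner ℝ x (planeNormal μ)] := by
  ext j
  fin_cases j <;>
    simp [Matrix.mulVec, dotProduct, planeBasis, planeNormal, PiLp.inner_apply]

/-- Coordinate-free form, which turns the geometric properties of the map into algebra with two
inner products. -/
theorem rotate_eq (x : EuclideanSpace ℝ (Fin (d + 2))) :
    rotate μ x = x +
      (((μ (Fin.last (d + 1)) - 1) * inner ℝ x (axis d) -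
        √(1 - μ (Fin.last (d + 1)) ^ 2) * inner ℝ x (planeNormal μ)) • axis d +
      (√(1 - μ (Fin.last (d + 1)) ^ 2) * inner ℝ x (axis d) +
        (μ (Fin.last (d + 1)) - 1) * inner ℝ x (planeNormal μ)) • planeNormal μ) := by
  ext i
  rw [rotate, planeBasis_transpose_mulVec]
  simp only [planeBasis, givens, planeNormal, Matrix.mulVec, dotProduct, Fin.sum_univ_two,
    Matrix.of_apply, Matrix.sub_apply, Matrix.cons_val', Matrix.cons_val_zero, Matrix.cons_val_one,
    Matrix.one_apply_eq, ne_eq, zero_ne_one, one_ne_zero, not_false_eq_true, Matrix.one_apply_ne,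
    sub_zero, Matrix.cons_val_fin_one, Pi.add_apply, PiLp.add_apply, PiLp.smul_apply, smul_eq_mul]
  ring

theorem norm_rotate {μ : EuclideanSpace ℝ (Fin (d + 2))} (hμ : ‖μ‖ = 1)
    (x : EuclideanSpace ℝ (Fin (d + 2))) : ‖rotate μ x‖ = ‖x‖ := by
  have hs := Real.sq_sqrt (last_sq_le_one hμ)
  have hi := inner_planeNormal_axis μ
  have hc := planeNormal_cases hμ
  rw [rotate_eq]
  -- Only `s² = 1 - c²`, orthogonality to the axis, and the alternative `‖v‖ = 1` or `v = 0`, `s =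
  -- 0` are needed from here on.
  generalize √(1 - μ (Fin.last (d + 1)) ^ 2) = s at *
  generalize μ (Fin.last (d + 1)) = c at *
  generalize planeNormal μ = v at *
  rw [← sq_eq_sq₀ (norm_nonneg _) (norm_nonneg _), norm_add_sq_real, norm_add_sq_real,
    inner_add_right, inner_smul_right, inner_smul_right, inner_smul_left, inner_smul_right,
    norm_smul, norm_smul, mul_pow, mul_pow, norm_axis, real_inner_comm v (axis d), hi,
    Real.norm_eq_abs, Real.norm_eq_abs, sq_abs, sq_abs]
  generalize inner ℝ x (axis d) = a
  rcases hc with hv | ⟨rfl, rfl⟩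
  · rw [hv]
    generalize inner ℝ x v = b
    linear_combination (a ^ 2 + b ^ 2) * hs
  · simp only [inner_zero_right, norm_zero]
    linear_combination a ^ 2 * hs

theorem rotate_axis {μ : EuclideanSpace ℝ (Fin (d + 2))} (hμ : ‖μ‖ = 1) :
    rotate μ (axis d) = μ := by
  have hi := inner_planeNormal_axis μ
  conv_rhs => rw [eq_smul_axis_add_smul_planeNormal hμ]
  rw [rotate_eq, real_inner_self_eq_norm_sq, norm_axis, real_inner_comm, hi]
  module

theorem rotate_eq_self_of_inner_eq_zero {x : EuclideanSpace ℝ (Fin (d + 2))}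
    (h1 : inner ℝ x (axis d) = 0) (h2 : inner ℝ x μ = 0) : rotate μ x = x := by
  have : inner ℝ x (planeNormal μ) = 0 := by
    rw [planeNormal, inner_smul_right, inner_sub_right, inner_smul_right, h1, h2]
    simp
  rw [rotate_eq, h1, this]
  simp

/-- The rotation as a linear isometry. -/
noncomputable def rotateIsometry {μ : EuclideanSpace ℝ (Fin (d + 2))} (hμ : ‖μ‖ = 1) :
    EuclideanSpace ℝ (Fin (d + 2)) ≃ₗᵢ[ℝ] EuclideanSpace ℝ (Fin (d + 2)) :=
  LinearIsometry.toLinearIsometryEquiv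
    { toFun := rotate μ
      map_add' := fun x y => by
        apply (WithLp.ofLp_injective 2)
        simp [rotate_ofLp, Matrix.mulVec_add]
      map_smul' := fun a x => by
        apply (WithLp.ofLp_injective 2)
        simp [rotate_ofLp, Matrix.mulVec_smul]
      norm_map' := norm_rotate hμ } rfl

@[simp]
theorem rotateIsometry_apply {μ : EuclideanSpace ℝ (Fin (d + 2))} (hμ : ‖μ‖ = 1)
    (x : EuclideanSpace ℝ (Fin (d + 2))) : rotateIsometry hμ x = rotate μ x := rfl

theorem planeBasis_transpose_mul {μ : EuclideanSpace ℝ (Fin (d + 2))}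
    (h : ‖planeNormal μ‖ = 1) : (planeBasis μ)ᵀ * planeBasis μ = 1 := by
  have hi := inner_planeNormal_axis μ
  have h1 : inner ℝ (axis d) (axis d) = 1 := by
    rw [real_inner_self_eq_norm_sq, norm_axis, one_pow]
  have h2 : inner ℝ (planeNormal μ) (planeNormal μ) = 1 := by
    rw [real_inner_self_eq_norm_sq, h, one_pow]
  have hi' : inner ℝ (axis d) (planeNormal μ) = 0 := by rw [real_inner_comm, hi]
  have e1 : (fun i => planeBasis μ i 0) = (axis d).ofLp := by ext i; simp [planeBasis]
  have e2 : (fun i => planeBasis μ i 1) = (planeNormal μ).ofLp := by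
    ext i; simp [planeBasis, planeNormal]
  have c1 : ∀ i, ((planeBasis μ)ᵀ * planeBasis μ) i 0 =
      ((planeBasis μ)ᵀ *ᵥ (axis d).ofLp) i := fun i => by rw [← e1]; rfl
  have c2 : ∀ i, ((planeBasis μ)ᵀ * planeBasis μ) i 1 =
      ((planeBasis μ)ᵀ *ᵥ (planeNormal μ).ofLp) i := fun i => by rw [← e2]; rfl
  ext i j
  fin_cases j
  · simp only [Fin.zero_eta, c1, planeBasis_transpose_mulVec, h1, hi']
    fin_cases i <;> simp
  · simp only [Fin.mk_one, c2, planeBasis_transpose_mulVec, h2, hi]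
    fin_cases i <;> simp

theorem givens_transpose_mul {c : ℝ} (hc : 0 ≤ 1 - c ^ 2) : (givens c)ᵀ * givens c = 1 := by
  have hs := Real.sq_sqrt hc
  ext i j
  fin_cases i <;> fin_cases j <;> simp [givens, Matrix.mul_apply, Fin.sum_univ_two] <;>
    first | ring1 | linear_combination hs

theorem det_givens {c : ℝ} (hc : 0 ≤ 1 - c ^ 2) : (givens c).det = 1 := by
  rw [givens, Matrix.det_fin_two_of]
  linear_combination Real.sq_sqrt hc

/-- When `P` has orthonormal columns, orthogonality of `1 + P (G - 1) Pᵀ` reduces to that of `G`,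
and `det (1 + AB) = det (1 + BA)` reduces the determinant to `det G`. For `μ = eₙ` the matrix is
`1`; for `μ = -eₙ` it is a reflection, of determinant `-1`. -/
theorem rotationMatrix_mem {μ : EuclideanSpace ℝ (Fin (d + 2))} (hμ : ‖μ‖ = 1)
    (hne : μ ≠ -axis d) :
    rotationMatrix μ ∈ Matrix.specialOrthogonalGroup (Fin (d + 2)) ℝ := by
  have hc := last_sq_le_one hμ
  rcases planeNormal_cases hμ with h | ⟨h0, hs⟩
  · have hP := planeBasis_transpose_mul h
    have hG := givens_transpose_mul hc
    rw [Matrix.mem_specialOrthogonalGroup_iff, Matrix.mem_orthogonalGroup_iff']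
    constructor
    · have hH : (givens (μ (Fin.last (d + 1))) - 1)ᵀ + (givens (μ (Fin.last (d + 1))) - 1) +
          (givens (μ (Fin.last (d + 1))) - 1)ᵀ * (givens (μ (Fin.last (d + 1))) - 1) = 0 := by
        rw [Matrix.transpose_sub, Matrix.transpose_one, sub_mul, mul_sub, mul_sub, hG]
        simp only [mul_one, one_mul]
        abel
      rw [rotationMatrix]
      generalize givens (μ (Fin.last (d + 1))) - 1 = H at *
      generalize planeBasis μ = Q at *
      calc (1 + Q * H * Qᵀ)ᵀ * (1 + Q * H * Qᵀ)
          = 1 + Q * (Hᵀ + H + Hᵀ * (Qᵀ * Q) * H) * Qᵀ := by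
            simp only [Matrix.transpose_add, Matrix.transpose_mul, Matrix.transpose_one,
              Matrix.transpose_transpose, Matrix.mul_add, Matrix.add_mul, Matrix.mul_assoc,
              Matrix.one_mul, Matrix.mul_one]
            abel
        _ = 1 := by rw [hP, Matrix.mul_one, hH]; simp
    · rw [rotationMatrix, Matrix.mul_assoc, Matrix.det_one_add_mul_comm, Matrix.mul_assoc, hP,
        Matrix.mul_one, add_sub_cancel, det_givens hc]
  · have hμe := eq_smul_axis_add_smul_planeNormal hμ
    rw [h0, smul_zero, add_zero] at hμe
    have h1 : μ (Fin.last (d + 1)) ^ 2 = 1 := by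
      have := Real.sqrt_eq_zero hc |>.1 hs
      linarith
    rcases (show μ (Fin.last (d + 1)) = 1 ∨ μ (Fin.last (d + 1)) = -1 by simpa using h1) with h | h
    · have : rotationMatrix μ = 1 := by
        have : givens (μ (Fin.last (d + 1))) = 1 := by
          rw [givens, hs, h]
          ext i j; fin_cases i <;> fin_cases j <;> simp
        rw [rotationMatrix, this]
        simp
      rw [this]
      exact one_mem _
    · exact absurd (by rw [hμe, h]; simp) hne

theorem rotate_preimage_hollowCone {μ : EuclideanSpace ℝ (Fin (d + 2))} (hμ : ‖μ‖ = 1)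
    (a b : ℝ) : rotate μ ⁻¹' hollowCone μ a b = hollowCone (axis d) a b := by
  ext x
  have : inner ℝ (rotate μ x) μ = inner ℝ x (axis d) := by
    have := (rotateIsometry hμ).inner_map_map x (axis d)
    rwa [rotateIsometry_apply, rotateIsometry_apply, rotate_axis hμ] at this
  simp only [hollowCone, mem_preimage, mem_ofPred_eq, norm_rotate hμ, this]

theorem measurable_rotate {μ : EuclideanSpace ℝ (Fin (d + 2))} (hμ : ‖μ‖ = 1) :
    Measurable (rotate μ) :=
  (rotateIsometry hμ).continuous.measurable

theorem map_rotate_surfaceMeasure {μ : EuclideanSpace ℝ (Fin (d + 2))} (hμ : ‖μ‖ = 1) :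
    (surfaceMeasure (d + 2)).map (rotate μ) = surfaceMeasure (d + 2) :=
  surfaceMeasure_map_linearIsometry (d + 1) (rotateIsometry hμ)

theorem surfaceMeasure_hollowCone {μ : EuclideanSpace ℝ (Fin (d + 2))} (hμ : ‖μ‖ = 1)
    (a b : ℝ) :
    surfaceMeasure (d + 2) (hollowCone μ a b) =
      surfaceMeasure (d + 2) (hollowCone (axis d) a b) := by
  conv_lhs => rw [← map_rotate_surfaceMeasure hμ]
  rw [Measure.map_apply (measurable_rotate hμ) (measurableSet_hollowCone _ _ _),
    rotate_preimage_hollowCone hμ]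

theorem surfaceMeasure_cap {μ : EuclideanSpace ℝ (Fin (d + 2))} (hμ : ‖μ‖ = 1) {θ : ℝ}
    (hθ : θ ∈ Icc 0 Real.pi) :
    surfaceMeasure (d + 2) (cap μ θ) =
      ENNReal.ofReal (sphereArea (d + 2) * solidFrac d θ) := by
  rw [← surfaceMeasure_cap_axis d hθ, cap_eq_hollowCone hμ, cap_eq_hollowCone (norm_axis d),
    surfaceMeasure_hollowCone hμ]

/-- The map preserves the surface measure and pulls the cone about `μ` back to the cone about the
axis. -/
theorem isUniform_rotate {μ : EuclideanSpace ℝ (Fin (d + 2))} (hμ : ‖μ‖ = 1) {a b : ℝ}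
    {Ω : Type*} [MeasurableSpace Ω] {P : Measure Ω}
    {X : Ω → EuclideanSpace ℝ (Fin (d + 2))} (hXm : AEMeasurable X P)
    (hX : pdf.IsUniform X (hollowCone (axis d) a b) P (surfaceMeasure (d + 2))) :
    pdf.IsUniform (fun ω => rotate μ (X ω)) (hollowCone μ a b) P (surfaceMeasure (d + 2)) := by
  have h := AEMeasurable.map_map_of_aemeasurable (measurable_rotate hμ).aemeasurable hXm
  rw [pdf.IsUniform] at hX ⊢
  rw [hX, ProbabilityTheory.cond, Measure.map_smul, ← rotate_preimage_hollowCone hμ,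
    ← Measure.restrict_map (measurable_rotate hμ) (measurableSet_hollowCone _ _ _),
    map_rotate_surfaceMeasure hμ, rotate_preimage_hollowCone hμ,
    ← surfaceMeasure_hollowCone hμ] at h
  exact h.symm

end Rotation

/-! ### The first success in a sequence of independent trials -/

section FirstHit

variable {E : Type*}

/-- The first index at which the sequence `x` is in `S`. -/
noncomputable def firstHit (S : Set E) (x : ℕ → E) : ℕ := sInf {k | x k ∈ S}

/-- A hit is required because `firstHit` takes the default value `sInf ∅ = 0` without one. -/
theorem le_firstHit_iff {S : Set E} {x : ℕ → E} (h : ∃ k, x k ∈ S) (k : ℕ) :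
    k ≤ firstHit S x ↔ ∀ i < k, x i ∉ S := by
  constructor
  · exact fun hk i hi hS => (Nat.sInf_le hS).not_gt (hi.trans_le hk)
  · intro hk
    by_contra hlt
    exact hk _ (not_le.1 hlt) (Nat.sInf_mem h)

theorem firstHit_eq {S : Set E} {x : ℕ → E} {k : ℕ} (hk : x k ∈ S) (h : ∀ i < k, x i ∉ S) :
    firstHit S x = k :=
  le_antisymm (Nat.sInf_le hk) ((le_firstHit_iff ⟨k, hk⟩ k).2 h)

variable [MeasurableSpace E] {S : Set E}

theorem measurable_firstHit (hS : MeasurableSet S) : Measurable (firstHit S) := by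
  have hk : ∀ k, MeasurableSet {x : ℕ → E | x k ∈ S} := fun k => measurable_pi_apply k hS
  have hex : MeasurableSet {x : ℕ → E | ∃ k, x k ∈ S} := by
    rw [ofPred_exists]; exact .iUnion hk
  refine measurable_of_Ici fun n => ?_
  rcases Nat.eq_zero_or_pos n with rfl | hn
  · simp
  have : firstHit S ⁻¹' Ici n =
      {x : ℕ → E | ∃ k, x k ∈ S} ∩ ⋂ i ∈ Iio n, {x : ℕ → E | x i ∈ S}ᶜ := by
    ext x
    simp only [mem_preimage, mem_Ici, mem_inter_iff, mem_ofPred_eq, mem_iInter, mem_Iio,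
      mem_compl_iff]
    constructor
    · intro h
      -- A positive infimum rules out the default value; this is why `n = 0` is treated apart.
      have hx : ∃ k, x k ∈ S := Nat.nonempty_of_pos_sInf (hn.trans_le h)
      exact ⟨hx, (le_firstHit_iff hx n).1 h⟩
    · exact fun h => (le_firstHit_iff h.1 n).2 h.2
  rw [this]
  exact hex.inter (.biInter (to_countable _) fun i _ => (hk i).compl)

theorem measurable_apply_firstHit (hS : MeasurableSet S) :
    Measurable fun x : ℕ → E => x (firstHit S x) := by
  have : Measurable fun p : (ℕ → E) × ℕ => p.1 p.2 :=
    measurable_from_prod_countable_left fun k => measurable_pi_apply k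
  exact this.comp (measurable_id.prodMk (measurable_firstHit hS))

variable (ν : Measure E) [IsProbabilityMeasure ν]

theorem infinitePi_forall_lt_notMem (hS : MeasurableSet S) (k : ℕ) :
    Measure.infinitePi (fun _ : ℕ => ν) {x | ∀ i < k, x i ∉ S} = ν Sᶜ ^ k := by
  have : {x : ℕ → E | ∀ i < k, x i ∉ S} = Set.pi (Finset.range k) fun _ => Sᶜ := by
    ext x; simp [Set.mem_pi]
  rw [this, Measure.infinitePi_pi _ fun _ _ => hS.compl]
  simp

theorem infinitePi_first_success (hS : MeasurableSet S) {B : Set E} (hB : MeasurableSet B)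
    (k : ℕ) :
    Measure.infinitePi (fun _ : ℕ => ν) {x | (∀ i < k, x i ∉ S) ∧ x k ∈ S ∩ B} =
      ν Sᶜ ^ k * ν (S ∩ B) := by
  have : {x : ℕ → E | (∀ i < k, x i ∉ S) ∧ x k ∈ S ∩ B} =
      Set.pi (Finset.range (k + 1)) fun i => if i < k then Sᶜ else S ∩ B := by
    ext x
    simp only [mem_ofPred_eq, Set.mem_pi, Finset.coe_range, mem_Iio]
    constructor
    · rintro ⟨h1, h2⟩ i hi
      by_cases hik : i < k
      · simpa [hik] using h1 i hik
      · obtain rfl : i = k := by omega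
        simpa using h2
    · intro h
      exact ⟨fun i hi => by simpa [hi] using h i (by omega), by simpa using h k (by omega)⟩
  rw [this, Measure.infinitePi_pi _ fun i _ => by split_ifs <;> measurability,
    Finset.prod_range_succ, Finset.prod_congr rfl fun i hi => by
      rw [if_pos (Finset.mem_range.1 hi)]]
  simp

theorem tsum_compl_pow (hS : MeasurableSet S) : ∑' k : ℕ, ν Sᶜ ^ k = (ν S)⁻¹ := by
  rw [ENNReal.tsum_geometric, prob_compl_eq_one_sub hS,
    ENNReal.sub_sub_cancel ENNReal.one_ne_top prob_le_one]

/-- Never succeeding entails `k` initial failures for every `k`, and `(ν Sᶜ) ^ k` tends to zero. -/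
theorem ae_exists_mem (hS : MeasurableSet S) (h0 : ν S ≠ 0) :
    ∀ᵐ x ∂Measure.infinitePi (fun _ : ℕ => ν), ∃ k, x k ∈ S := by
  have hq : ν Sᶜ < 1 := by
    rw [prob_compl_eq_one_sub hS]
    exact ENNReal.sub_lt_self ENNReal.one_ne_top one_ne_zero h0
  rw [ae_iff]
  refine le_antisymm (ge_of_tendsto' (ENNReal.tendsto_pow_atTop_nhds_zero_of_lt_one hq)
    fun k => ?_) zero_le
  rw [← infinitePi_forall_lt_notMem ν hS]
  exact measure_mono fun x hx i _ hi => hx ⟨i, hi⟩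

/-- Tail-sum formula: the number of trials is the sum over `k` of the indicator of `k` initial
failures, and the probabilities form a geometric series. -/
theorem lintegral_firstHit (hS : MeasurableSet S) (h0 : ν S ≠ 0) :
    ∫⁻ x, ((firstHit S x + 1 : ℕ) : ℝ≥0∞) ∂Measure.infinitePi (fun _ : ℕ => ν) = (ν S)⁻¹ := by
  have hm : ∀ k : ℕ, MeasurableSet {x : ℕ → E | ∀ i < k, x i ∉ S} := fun k => by
    have : {x : ℕ → E | ∀ i < k, x i ∉ S} = ⋂ i ∈ Iio k, {x : ℕ → E | x i ∈ S}ᶜ := by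
      ext x; simp
    rw [this]
    exact .biInter (to_countable _) fun i _ => (measurable_pi_apply i hS).compl
  have : ∀ᵐ x ∂Measure.infinitePi (fun _ : ℕ => ν), ((firstHit S x + 1 : ℕ) : ℝ≥0∞) =
      ∑' k : ℕ, {x : ℕ → E | ∀ i < k, x i ∉ S}.indicator 1 x := by
    filter_upwards [ae_exists_mem ν hS h0] with x hx
    have : ∀ k : ℕ, {x : ℕ → E | ∀ i < k, x i ∉ S}.indicator (1 : (ℕ → E) → ℝ≥0∞) x =
        if k ∈ Finset.range (firstHit S x + 1) then 1 else 0 := fun k => by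
      simp only [indicator, mem_ofPred_eq, ← le_firstHit_iff hx, Finset.mem_range,
        Nat.lt_succ_iff, Pi.one_apply]
    simp_rw [this]
    rw [tsum_eq_sum (s := Finset.range (firstHit S x + 1)) fun k hk => if_neg hk,
      Finset.sum_congr rfl fun k hk => if_pos hk]
    simp
  rw [lintegral_congr_ae this, lintegral_tsum fun k =>
    (measurable_one.indicator (hm k)).aemeasurable, ← tsum_compl_pow ν hS]
  refine tsum_congr fun k => ?_
  rw [lintegral_indicator_one (hm k), infinitePi_forall_lt_notMem ν hS]

/-- Split according to the index `k` of the first success: the disjoint events have probabilities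
`(ν Sᶜ) ^ k * ν (S ∩ B)`, with sum `ν (S ∩ B) / ν S`. -/
theorem map_apply_firstHit (hS : MeasurableSet S) (h0 : ν S ≠ 0) :
    (Measure.infinitePi fun _ : ℕ => ν).map (fun x => x (firstHit S x)) = cond ν S := by
  refine Measure.ext fun B hB => ?_
  rw [Measure.map_apply (measurable_apply_firstHit hS) hB, cond_apply hS]
  set A : ℕ → Set (ℕ → E) := fun k => {x | (∀ i < k, x i ∉ S) ∧ x k ∈ S ∩ B}
  have hA : ∀ k, MeasurableSet (A k) := fun k => by
    have : A k = (⋂ i ∈ Iio k, {x : ℕ → E | x i ∈ S}ᶜ) ∩ {x : ℕ → E | x k ∈ S ∩ B} := by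
      ext x; simp [A]
    rw [this]
    exact (MeasurableSet.biInter (to_countable _) fun i _ =>
      (measurable_pi_apply i hS).compl).inter (measurable_pi_apply k (hS.inter hB))
  have hae : (fun x : ℕ → E => x (firstHit S x)) ⁻¹' B
      =ᵐ[Measure.infinitePi fun _ : ℕ => ν] ⋃ k, A k := by
    filter_upwards [ae_exists_mem ν hS h0] with x hx
    refine propext ⟨fun h => ?_, fun h => ?_⟩
    · exact mem_iUnion.2 ⟨firstHit S x, (le_firstHit_iff hx _).1 le_rfl, Nat.sInf_mem hx, h⟩
    · obtain ⟨k, hk, hkS, hkB⟩ := mem_iUnion.1 h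
      change x (firstHit S x) ∈ B
      rwa [firstHit_eq hkS hk]
  have hdisj : Pairwise (Function.onFun Disjoint A) := by
    intro j k hjk
    refine Set.disjoint_left.2 fun x hj hk => hjk ?_
    rw [← firstHit_eq hj.2.1 hj.1, firstHit_eq hk.2.1 hk.1]
  rw [measure_congr hae, measure_iUnion hdisj hA]
  simp_rw [A, infinitePi_first_success ν hS hB]
  rw [ENNReal.tsum_mul_right, tsum_compl_pow ν hS]

end FirstHit

/-! ### Rejection sampling of the planar angle -/

/-- The pairs `(u, t)` accepted by the rejection loop. -/
def acceptSet (d : ℕ) (θ₀ : ℝ) : Set (ℝ × ℝ) :=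
  {p | (rejectionPass d (rejectionLevel d θ₀) p.1 p.2).val}

theorem mem_acceptSet {d : ℕ} {θ₀ : ℝ} {p : ℝ × ℝ} :
    p ∈ acceptSet d θ₀ ↔
      rejectionLevel d θ₀ + Real.log p.1 < (d : ℝ) * Real.log (Real.sin p.2) := Iff.rfl

theorem measurableSet_acceptSet (d : ℕ) (θ₀ : ℝ) : MeasurableSet (acceptSet d θ₀) :=
  measurableSet_lt (f := fun p : ℝ × ℝ => rejectionLevel d θ₀ + Real.log p.1)
    (g := fun p : ℝ × ℝ => (d : ℝ) * Real.log (Real.sin p.2)) (by fun_prop) (by fun_prop)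

/-- The law of the pair drawn in one pass. -/
noncomputable def drawLaw (θ₀ : ℝ) : Measure (ℝ × ℝ) :=
  (cond volume (Icc (0 : ℝ) 1)).prod (cond volume (Icc 0 θ₀))

theorem isProbabilityMeasure_cond_Icc {a b : ℝ} (h : a < b) :
    IsProbabilityMeasure (cond (volume : Measure ℝ) (Icc a b)) :=
  cond_isProbabilityMeasure_of_finite (by simpa using h) (by simp)

theorem isProbabilityMeasure_drawLaw {θ₀ : ℝ} (h : 0 < θ₀) :
    IsProbabilityMeasure (drawLaw θ₀) := by
  have := isProbabilityMeasure_cond_Icc h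
  have := isProbabilityMeasure_cond_Icc (zero_lt_one (α := ℝ))
  unfold drawLaw
  infer_instance

section Accept

variable (d : ℕ) {θ₀ : ℝ} (h0 : 0 < θ₀) (hπ : θ₀ ≤ Real.pi)

theorem min_pi_div_two_mem (h0 : 0 < θ₀) : min θ₀ (Real.pi / 2) ∈ Ioc 0 (Real.pi / 2) :=
  ⟨lt_min h0 (by positivity), min_le_right _ _⟩

include h0 in
theorem sin_min_pos : 0 < Real.sin (min θ₀ (Real.pi / 2)) := by
  have := min_pi_div_two_mem h0
  exact Real.sin_pos_of_pos_of_lt_pi this.1 (by linarith [this.2, Real.pi_pos])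

/-- This keeps the acceptance probability at most one. -/
theorem sin_le_sin_min {t : ℝ} (ht : t ∈ Icc 0 θ₀) :
    Real.sin t ≤ Real.sin (min θ₀ (Real.pi / 2)) := by
  rcases le_total θ₀ (Real.pi / 2) with h | h
  · rw [min_eq_left h]
    exact Real.sin_le_sin_of_le_of_le_pi_div_two (by linarith [ht.1, Real.pi_pos]) h ht.2
  · rw [min_eq_right h, Real.sin_pi_div_two]
    exact Real.sin_le_one t

include h0 hπ in
-- Exponentiated, the test reads `u < (sin t / M) ^ d`, with right-hand side in `[0, 1]`.
theorem volume_acceptSet_section {t : ℝ} (ht : t ∈ Ioo 0 θ₀) :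
    cond (volume : Measure ℝ) (Icc (0 : ℝ) 1) {u | (u, t) ∈ acceptSet d θ₀} =
      ENNReal.ofReal ((Real.sin (min θ₀ (Real.pi / 2)) ^ d)⁻¹ * Real.sin t ^ d) := by
  set M := Real.sin (min θ₀ (Real.pi / 2)) with hMdef
  have hM : 0 < M := sin_min_pos h0
  have hs : 0 < Real.sin t := Real.sin_pos_of_pos_of_lt_pi ht.1 (ht.2.trans_le hπ)
  have hle : (M ^ d)⁻¹ * Real.sin t ^ d ≤ 1 := by
    rw [inv_mul_le_one₀ (by positivity)]
    exact pow_le_pow_left₀ hs.le (sin_le_sin_min ⟨ht.1.le, ht.2.le⟩) d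
  have hiff : ∀ u : ℝ, 0 < u → ((u, t) ∈ acceptSet d θ₀ ↔ u < (M ^ d)⁻¹ * Real.sin t ^ d) := by
    intro u hu
    rw [mem_acceptSet, rejectionLevel, ← hMdef, ← Real.log_pow, ← Real.log_pow,
      ← Real.log_mul (by positivity) hu.ne', Real.log_lt_log_iff (by positivity) (by positivity),
      lt_inv_mul_iff₀ (by positivity)]
  -- The point `u = 0`, where `Real.log` has the default value `0`, is left out as a null set.
  have heq : Ioc (0 : ℝ) 1 ∩ {u | (u, t) ∈ acceptSet d θ₀} =
      Ioo 0 ((M ^ d)⁻¹ * Real.sin t ^ d) := by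
    ext u
    constructor
    · exact fun h => ⟨h.1.1, (hiff u h.1.1).1 h.2⟩
    · exact fun h => ⟨⟨h.1, h.2.le.trans hle⟩, (hiff u h.1).2 h.2⟩
  have hae : (Icc (0 : ℝ) 1 ∩ {u | (u, t) ∈ acceptSet d θ₀} : Set ℝ) =ᵐ[volume]
      (Ioc (0 : ℝ) 1 ∩ {u | (u, t) ∈ acceptSet d θ₀} : Set ℝ) :=
    Ioc_ae_eq_Icc.symm.inter (ae_eq_refl _)
  rw [cond_apply measurableSet_Icc, measure_congr hae, heq]
  simp

include h0 hπ in
-- Tonelli with `t` as outer variable: the acceptance probability is the density in `t`. The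
-- endpoints of `[0, θ₀]`, where `sin` may vanish, are null.
theorem map_snd_drawLaw_restrict :
    ((drawLaw θ₀).restrict (acceptSet d θ₀)).map Prod.snd =
      ENNReal.ofReal ((θ₀ * Real.sin (min θ₀ (Real.pi / 2)) ^ d)⁻¹) •
        (sinPowMeasure d).restrict (Icc 0 θ₀) := by
  have hM := sin_min_pos h0
  have := isProbabilityMeasure_cond_Icc h0
  have := isProbabilityMeasure_cond_Icc (zero_lt_one (α := ℝ))
  refine Measure.ext fun B hB => ?_
  have hBm : MeasurableSet (Prod.snd ⁻¹' B : Set (ℝ × ℝ)) := measurable_snd hB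
  rw [Measure.map_apply measurable_snd hB, Measure.restrict_apply hBm, drawLaw,
    Measure.prod_apply_symm (hBm.inter (measurableSet_acceptSet d θ₀)), Measure.smul_apply,
    Measure.restrict_apply hB, sinPowMeasure, withDensity_apply _ (hB.inter measurableSet_Icc),
    Measure.restrict_restrict (hB.inter measurableSet_Icc), inter_assoc,
    inter_eq_left.2 (Icc_subset_Icc le_rfl hπ), smul_eq_mul,
    show cond (volume : Measure ℝ) (Icc 0 θ₀) =
      (volume (Icc 0 θ₀))⁻¹ • volume.restrict (Icc 0 θ₀) from rfl,
    lintegral_smul_measure, Real.volume_Icc, sub_zero, mul_inv,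
    ENNReal.ofReal_mul (by positivity), ENNReal.ofReal_inv_of_pos h0, smul_eq_mul, mul_assoc,
    ← Measure.restrict_restrict hB, ← lintegral_indicator hB,
    ← Measure.restrict_congr_set Ioo_ae_eq_Icc]
  congr 1
  rw [← lintegral_const_mul _ (Measurable.indicator (by fun_prop) hB)]
  refine setLIntegral_congr_fun measurableSet_Ioo fun t ht => ?_
  by_cases htB : t ∈ B
  · have : (fun u : ℝ => (u, t)) ⁻¹' (Prod.snd ⁻¹' B ∩ acceptSet d θ₀) =
        {u | (u, t) ∈ acceptSet d θ₀} := by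
      ext u; simp [htB]
    rw [this, volume_acceptSet_section d h0 hπ ht, indicator_of_mem htB,
      ENNReal.ofReal_mul (by positivity)]
  · have : (fun u : ℝ => (u, t)) ⁻¹' (Prod.snd ⁻¹' B ∩ acceptSet d θ₀) = ∅ := by
      ext u; simp [htB]
    rw [this, measure_empty, indicator_of_notMem htB, mul_zero]

include h0 hπ in
theorem drawLaw_acceptSet :
    drawLaw θ₀ (acceptSet d θ₀) = ENNReal.ofReal
      ((θ₀ * Real.sin (min θ₀ (Real.pi / 2)) ^ d)⁻¹ *
        (beta (((d : ℝ) + 1) / 2) (1 / 2) * solidFrac d θ₀)) := by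
  have hM := sin_min_pos h0
  have h := congrArg (fun μ => μ univ) (map_snd_drawLaw_restrict d h0 hπ)
  simp only [Measure.map_apply measurable_snd .univ, preimage_univ, Measure.restrict_apply_univ,
    Measure.smul_apply, smul_eq_mul] at h
  rw [h, sinPowMeasure_Icc d le_rfl h0.le hπ, solidFrac_zero, sub_zero,
    ENNReal.ofReal_mul (p := (θ₀ * Real.sin (min θ₀ (Real.pi / 2)) ^ d)⁻¹) (by positivity)]

include h0 hπ in
theorem drawLaw_acceptSet_ne_zero : drawLaw θ₀ (acceptSet d θ₀) ≠ 0 := by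
  have hM := sin_min_pos h0
  have hΘ := solidFrac_pos d h0 hπ
  have hβ := beta_half_pos d
  rw [drawLaw_acceptSet d h0 hπ]
  simp only [ne_eq, ENNReal.ofReal_eq_zero, not_le]
  positivity

include h0 hπ in
theorem inv_drawLaw_acceptSet :
    (drawLaw θ₀ (acceptSet d θ₀))⁻¹ = ENNReal.ofReal
      (θ₀ * Real.sin (min θ₀ (Real.pi / 2)) ^ d /
        (beta (((d : ℝ) + 1) / 2) (1 / 2) * solidFrac d θ₀)) := by
  have hM := sin_min_pos h0
  have hΘ := solidFrac_pos d h0 hπ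
  have hβ := beta_half_pos d
  rw [drawLaw_acceptSet d h0 hπ, ← ENNReal.ofReal_inv_of_pos (by positivity), mul_inv, inv_inv,
    ← div_eq_mul_inv]

include h0 hπ in
theorem map_snd_cond_drawLaw :
    (cond (drawLaw θ₀) (acceptSet d θ₀)).map Prod.snd = angleLaw d θ₀ := by
  have := isProbabilityMeasure_drawLaw h0
  have := cond_isProbabilityMeasure (drawLaw_acceptSet_ne_zero d h0 hπ)
  have : IsProbabilityMeasure ((cond (drawLaw θ₀) (acceptSet d θ₀)).map Prod.snd) :=
    Measure.isProbabilityMeasure_map (by fun_prop)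
  rw [angleLaw_eq_cond d h0 hπ]
  refine eq_cond_of_eq_smul (c := (drawLaw θ₀ (acceptSet d θ₀))⁻¹ *
    ENNReal.ofReal ((θ₀ * Real.sin (min θ₀ (Real.pi / 2)) ^ d)⁻¹)) ?_
  rw [ProbabilityTheory.cond, Measure.map_smul, map_snd_drawLaw_restrict d h0 hπ, smul_smul]

include h0 hπ in
/-- The expected number of passes is at most linear in the dimension. -/
theorem expected_passes_le :
    θ₀ * Real.sin (min θ₀ (Real.pi / 2)) ^ d /
      (beta (((d : ℝ) + 1) / 2) (1 / 2) * solidFrac d θ₀) ≤ 2 * ((d : ℝ) + 1) := by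
  have hM := sin_min_pos h0
  have hΘ := solidFrac_pos d h0 hπ
  have hβ := beta_half_pos d
  have ha := min_pi_div_two_mem h0
  -- Since `θ₀ ≤ π`; this is the source of the factor `2`.
  have ha2 : θ₀ ≤ 2 * min θ₀ (Real.pi / 2) := by
    rcases le_total θ₀ (Real.pi / 2) with h | h
    · rw [min_eq_left h]; linarith
    · rw [min_eq_right h]; linarith
  rw [div_le_iff₀ (by positivity), mul_comm (beta _ _), solidFrac_mul_beta]
  have haθ : min θ₀ (Real.pi / 2) ≤ θ₀ := min_le_left _ _
  generalize min θ₀ (Real.pi / 2) = a at *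
  set M := Real.sin a with hMdef
  have hc : Continuous fun t => Real.sin t ^ d := by fun_prop
  -- By concavity, `sin` lies above its chord from `0` to `a`; the `d`-th power of the chord
  -- integrates to `M ^ d * a / (d + 1)`.
  have h1 : ∫ t in (0 : ℝ)..a, (M / a * t) ^ d ≤ ∫ t in (0 : ℝ)..a, Real.sin t ^ d := by
    refine intervalIntegral.integral_mono_on ha.1.le
      ((by fun_prop : Continuous fun t : ℝ => (M / a * t) ^ d).intervalIntegrable _ _)
      (hc.intervalIntegrable _ _) fun t ht => ?_
    have ht0 : 0 ≤ M / a * t := mul_nonneg (div_nonneg hM.le ha.1.le) ht.1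
    refine pow_le_pow_left₀ ht0 ?_ d
    have hconc := strictConcaveOn_sin_Icc.concaveOn.2
      (show (0 : ℝ) ∈ Icc 0 Real.pi from left_mem_Icc.2 Real.pi_pos.le)
      (show a ∈ Icc 0 Real.pi from ⟨ha.1.le, haθ.trans hπ⟩)
      (show 0 ≤ 1 - t / a from sub_nonneg.2 ((div_le_one ha.1).2 ht.2))
      (show 0 ≤ t / a from div_nonneg ht.1 ha.1.le) (by ring)
    simp only [Real.sin_zero, smul_eq_mul, mul_zero, zero_add, ← hMdef,
      div_mul_cancel₀ t ha.1.ne'] at hconc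
    calc M / a * t = t / a * M := by ring
      _ ≤ Real.sin t := hconc
  have h2 : ∫ t in (0 : ℝ)..a, (M / a * t) ^ d = M ^ d * a / (d + 1) := by
    simp_rw [mul_pow]
    rw [intervalIntegral.integral_const_mul, integral_pow]
    have := ha.1.ne'
    rw [zero_pow (by omega), sub_zero, div_pow]
    field_simp
    ring
  have h3 : ∫ t in (0 : ℝ)..a, Real.sin t ^ d ≤ ∫ t in (0 : ℝ)..θ₀, Real.sin t ^ d := by
    rw [← intervalIntegral.integral_add_adjacent_intervals (hc.intervalIntegrable 0 a)
      (hc.intervalIntegrable a θ₀)]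
    refine le_add_of_nonneg_right (intervalIntegral.integral_nonneg haθ fun t ht => ?_)
    exact pow_nonneg (Real.sin_nonneg_of_mem_Icc ⟨ha.1.le.trans ht.1, ht.2.trans hπ⟩) d
  have h4 : M ^ d * a / (d + 1) ≤ ∫ t in (0 : ℝ)..θ₀, Real.sin t ^ d :=
    h2 ▸ h1.trans h3
  have hMd : 0 < M ^ d := pow_pos hM d
  calc θ₀ * M ^ d ≤ 2 * a * M ^ d := by gcongr
    _ = 2 * ((d : ℝ) + 1) * (M ^ d * a / (d + 1)) := by field_simp
    _ ≤ _ := by gcongr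

end Accept

section Source

variable (d : ℕ) {θ₀ : ℝ} {Ω : Type*} [MeasurableSpace Ω] {P : Measure Ω} {U T : ℕ → Ω → ℝ}

theorem IsRejectionSource.aemeasurable (h0 : 0 < θ₀) (h : IsRejectionSource P θ₀ U T) (k : ℕ) :
    AEMeasurable (fun ω => (U k ω, T k ω)) P :=
  (aemeasurable_of_isUniform_Icc zero_lt_one (h.2.2.1 k)).prodMk
    (aemeasurable_of_isUniform_Icc h0 (h.2.2.2 k))

theorem IsRejectionSource.aemeasurable_pi (h0 : 0 < θ₀) (h : IsRejectionSource P θ₀ U T) :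
    AEMeasurable (fun ω k => (U k ω, T k ω)) P :=
  aemeasurable_pi_lambda _ (h.aemeasurable h0)

variable [IsProbabilityMeasure P]

/-- Independence within and between passes makes the pairs i.i.d., so the first-success results on
the product space apply. -/
theorem IsRejectionSource.map_eq (h0 : 0 < θ₀) (h : IsRejectionSource P θ₀ U T) :
    P.map (fun ω k => (U k ω, T k ω)) = Measure.infinitePi fun _ : ℕ => drawLaw θ₀ := by
  rw [(iIndepFun_iff_map_fun_eq_infinitePi_map₀' (h.aemeasurable h0)).1 h.1]
  congr 1
  ext1 k
  rw [(indepFun_iff_map_prod_eq_prod_map_map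
    (aemeasurable_of_isUniform_Icc zero_lt_one (h.2.2.1 k))
    (aemeasurable_of_isUniform_Icc h0 (h.2.2.2 k))).1 (h.2.1 k), h.2.2.1 k, h.2.2.2 k, drawLaw]

theorem IsRejectionSource.ae_exists_accept (h0 : 0 < θ₀) (hπ : θ₀ ≤ Real.pi)
    (h : IsRejectionSource P θ₀ U T) :
    ∀ᵐ ω ∂P, ∃ k, (U k ω, T k ω) ∈ acceptSet d θ₀ := by
  have := isProbabilityMeasure_drawLaw h0
  have hae := ae_exists_mem (drawLaw θ₀) (measurableSet_acceptSet d θ₀)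
    (drawLaw_acceptSet_ne_zero d h0 hπ)
  rw [← h.map_eq h0] at hae
  exact ae_of_ae_map (h.aemeasurable_pi h0) hae

/-- The planar angle returned by the rejection loop, as a function of the draws. -/
noncomputable def acceptedAngle (d : ℕ) (θ₀ : ℝ) (x : ℕ → ℝ × ℝ) : ℝ :=
  (x (firstHit (acceptSet d θ₀) x)).2

theorem measurable_acceptedAngle (d : ℕ) (θ₀ : ℝ) : Measurable (acceptedAngle d θ₀) :=
  measurable_snd.comp (measurable_apply_firstHit (measurableSet_acceptSet d θ₀))

theorem IsRejectionSource.hasLaw (h0 : 0 < θ₀) (hπ : θ₀ ≤ Real.pi)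
    (h : IsRejectionSource P θ₀ U T) :
    HasLaw (fun ω => acceptedAngle d θ₀ fun k => (U k ω, T k ω)) (angleLaw d θ₀) P := by
  have := isProbabilityMeasure_drawLaw h0
  refine ⟨(measurable_acceptedAngle d θ₀).comp_aemeasurable (h.aemeasurable_pi h0), ?_⟩
  have h1 := AEMeasurable.map_map_of_aemeasurable (g := acceptedAngle d θ₀)
    (measurable_acceptedAngle d θ₀).aemeasurable (h.aemeasurable_pi h0)
  have h2 := Measure.map_map (μ := Measure.infinitePi fun _ : ℕ => drawLaw θ₀) measurable_snd
    (measurable_apply_firstHit (measurableSet_acceptSet d θ₀))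
  rw [map_apply_firstHit _ (measurableSet_acceptSet d θ₀) (drawLaw_acceptSet_ne_zero d h0 hπ),
    map_snd_cond_drawLaw d h0 hπ] at h2
  rw [h.map_eq h0] at h1
  exact h1.symm.trans h2.symm

theorem IsRejectionSource.lintegral_passes (h0 : 0 < θ₀) (hπ : θ₀ ≤ Real.pi)
    (h : IsRejectionSource P θ₀ U T) :
    ∫⁻ ω, (rejectionPasses d θ₀ (fun k => U k ω) (fun k => T k ω) : ℝ≥0∞) ∂P =
      ENNReal.ofReal (θ₀ * Real.sin (min θ₀ (Real.pi / 2)) ^ d /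
        (beta (((d : ℝ) + 1) / 2) (1 / 2) * solidFrac d θ₀)) := by
  have := isProbabilityMeasure_drawLaw h0
  have hm : Measurable fun x : ℕ → ℝ × ℝ =>
      ((firstHit (acceptSet d θ₀) x + 1 : ℕ) : ℝ≥0∞) :=
    (measurable_of_countable fun n : ℕ => ((n + 1 : ℕ) : ℝ≥0∞)).comp
      (measurable_firstHit (measurableSet_acceptSet d θ₀))
  have h1 := lintegral_firstHit (drawLaw θ₀) (measurableSet_acceptSet d θ₀)
    (drawLaw_acceptSet_ne_zero d h0 hπ)
  rw [← h.map_eq h0, lintegral_map' hm.aemeasurable (h.aemeasurable_pi h0),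
    inv_drawLaw_acceptSet d h0 hπ] at h1
  exact h1

end Source

/-! ### The algorithms: results and operation counts -/

@[simp]
theorem Counted.val_bind {α β : Type} (x : Counted α) (f : α → Counted β) :
    (x >>= f).val = (f x.val).val := rfl

@[simp]
theorem Counted.ops_bind {α β : Type} (x : Counted α) (f : α → Counted β) :
    (x >>= f).ops = x.ops + (f x.val).ops := rfl

@[simp]
theorem Counted.ops_pure {α : Type} (a : α) : (pure a : Counted α).ops = 0 := rfl

@[simp]
theorem val_tick {α : Type} (a : α) : (tick a).val = a := rfl

@[simp]
theorem ops_tick {α : Type} (a : α) : (tick a).ops = 1 := rfl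

@[simp]
theorem ops_forVec_tick {m : ℕ} (f : Fin m → ℝ) : (forVec fun i => tick (f i)).ops = m := by
  simp [forVec]

@[simp]
theorem ops_forSum_tick {m : ℕ} (f : Fin m → ℝ) :
    (forSum fun i => tick (f i)).ops = 2 * m := by
  simp [forSum, mul_comm]

@[simp]
theorem ops_mulVecC {p q : ℕ} (A : Matrix (Fin p) (Fin q) ℝ) (v : Fin q → ℝ) :
    (mulVecC A v).ops = p * (2 * q) := by
  simp only [mulVecC, forVec, ops_forSum_tick]
  simp

@[simp]
theorem val_mulVecC {p q : ℕ} (A : Matrix (Fin p) (Fin q) ℝ) (v : Fin q → ℝ) :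
    (mulVecC A v).val = A *ᵥ v := rfl

theorem ops_spherePointAlg {m : ℕ} (z : Fin m → ℝ) : (spherePointAlg z).ops = 4 * m + 1 := by
  simp [spherePointAlg]
  ring

/-- With `n = d + 2`: forming the two columns and the final sum cost `n` each, the products with
`Pᵀ` and `P` cost `4 * n` each; the scalars add `9` and the `2 × 2` product `8`. -/
theorem ops_rotateAlg {d : ℕ} (x μ : Fin (d + 2) → ℝ) :
    (rotateAlg x μ).ops = 11 * (d + 2) + 17 := by
  simp [rotateAlg]
  ring

/-- Since `‖μ - μₙ eₙ‖ = √(1 - μₙ²)`, the computed columns are those of `planeBasis`; if `μ = ±eₙ`,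
division by zero gives the zero column in both. -/
theorem toLp_val_rotateAlg {d : ℕ} {μ : EuclideanSpace ℝ (Fin (d + 2))} (hμ : ‖μ‖ = 1)
    (x : EuclideanSpace ℝ (Fin (d + 2))) :
    WithLp.toLp 2 (rotateAlg x.ofLp μ.ofLp).val = rotate μ x := by
  set c := μ (Fin.last (d + 1)) with hc
  set s := √(1 - c ^ 2) with hs
  have h1 : (rotateAlg x.ofLp μ.ofLp).val = x.ofLp +
      (Matrix.of fun i j => ![if i = Fin.last (d + 1) then (1 : ℝ) else 0,
          if i = Fin.last (d + 1) then 0 else μ i / s] j) *ᵥ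
        (!![c - 1, -s - 0; s - 0, c - 1] *ᵥ
          ((Matrix.of fun i j => ![if i = Fin.last (d + 1) then (1 : ℝ) else 0,
            if i = Fin.last (d + 1) then 0 else μ i / s] j)ᵀ *ᵥ x.ofLp)) := rfl
  have h2 : (Matrix.of fun i j => ![if i = Fin.last (d + 1) then (1 : ℝ) else 0,
      if i = Fin.last (d + 1) then 0 else μ i / s] j) = planeBasis μ := by
    ext i j
    fin_cases j
    · simp [planeBasis, axis]
    · have hn : ‖μ - c • axis d‖ = s := norm_sub_smul_axis hμ
      simp only [Fin.mk_one, Matrix.of_apply, Matrix.cons_val_one, Matrix.cons_val_fin_one,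
        planeBasis, ← hc, hn]
      by_cases hi : i = Fin.last (d + 1)
      · subst hi; simp [axis, hc]
      · simp [axis, hi, div_eq_inv_mul]
  have h3 : !![c - 1, -s - 0; s - 0, c - 1] = givens c - 1 := by
    ext i j
    fin_cases i <;> fin_cases j <;> simp [givens, hs]
  rw [h1, h2, h3]
  rfl

theorem toLp_val_capPointAlg {d : ℕ} {μ : EuclideanSpace ℝ (Fin (d + 2))} (hμ : ‖μ‖ = 1)
    (angle : Counted ℝ) (z : Fin (d + 1) → ℝ) :
    WithLp.toLp 2 (capPointAlg angle z μ.ofLp).val = rotate μ (capPoint angle.val z) := by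
  rw [capPoint_eq_polarPoint, ← toLp_val_rotateAlg hμ]
  rfl

theorem ops_capPointAlg {d : ℕ} (angle : Counted ℝ) (z : Fin (d + 1) → ℝ)
    (μ : Fin (d + 2) → ℝ) :
    (capPointAlg angle z μ).ops = angle.ops + (16 * d + 47) := by
  simp [capPointAlg, ops_spherePointAlg, ops_rotateAlg]
  ring

theorem ops_inverseAngleAlg (d : ℕ) (θ₀ : ℝ) (u : ℝ → ℝ) : (inverseAngleAlg d θ₀ u).ops = 3 := by
  simp [inverseAngleAlg]

theorem ops_hollowAngleAlg (d : ℕ) (Ω₁ Ω₂ u : ℝ) : (hollowAngleAlg d Ω₁ Ω₂ u).ops = 5 := by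
  simp [hollowAngleAlg]

theorem ops_rejectionAngleAlg (d : ℕ) (θ₀ : ℝ) (u t : ℕ → ℝ) :
    (rejectionAngleAlg d θ₀ u t).ops = 4 + 8 * rejectionPasses d θ₀ u t := by
  have : ∀ h a b, (rejectionPass d h a b).ops = 8 := fun h a b => by simp [rejectionPass]
  simp only [rejectionAngleAlg, Counted.ops_bind, ops_tick, Counted.ops_pure, repeatUntil, this,
    Finset.sum_const, Finset.card_range, smul_eq_mul, rejectionPasses, rejectionLevel, val_tick]
  ring

/-- The rotated cap points computed from an angle with the law of the cap. -/
theorem isUniform_rotate_capPoint {d : ℕ} {μ : EuclideanSpace ℝ (Fin (d + 2))} (hμ : ‖μ‖ = 1)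
    {a b : ℝ} (ha : 0 ≤ a) (hab : a ≤ b) (hb : b ≤ Real.pi)
    {Ω : Type*} [MeasurableSpace Ω] {P : Measure Ω} [IsProbabilityMeasure P]
    {θ : Ω → ℝ} {Z : Fin (d + 1) → Ω → ℝ} (hθ : AEMeasurable θ P)
    (hmap : P.map θ = cond (sinPowMeasure d) (Icc a b)) (hZ : IsStdNormalFamily P Z)
    (hind : IndepFun θ (fun ω i => Z i ω) P) :
    pdf.IsUniform (fun ω => rotate μ (capPoint (θ ω) fun i => Z i ω)) (hollowCone μ a b) P
      (surfaceMeasure (d + 2)) := by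
  refine isUniform_rotate hμ ?_ (isUniform_capPoint d ha hab hb hθ hmap hZ hind)
  simp_rw [capPoint_eq_polarPoint]
  exact measurable_polarPoint.comp_aemeasurable
    (hθ.prodMk (measurable_normalized.comp_aemeasurable hZ.aemeasurable))

theorem isUniform_rotate_capPoint_cap {d : ℕ} {μ : EuclideanSpace ℝ (Fin (d + 2))}
    (hμ : ‖μ‖ = 1) {θ₀ : ℝ} (h0 : 0 < θ₀) (hπ : θ₀ ≤ Real.pi)
    {Ω : Type*} [MeasurableSpace Ω] {P : Measure Ω} [IsProbabilityMeasure P]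
    {θ : Ω → ℝ} {Z : Fin (d + 1) → Ω → ℝ} (hθ : HasLaw θ (angleLaw d θ₀) P)
    (hZ : IsStdNormalFamily P Z) (hind : IndepFun θ (fun ω i => Z i ω) P) :
    pdf.IsUniform (fun ω => rotate μ (capPoint (θ ω) fun i => Z i ω)) (cap μ θ₀) P
      (surfaceMeasure (d + 2)) := by
  rw [cap_eq_hollowCone hμ]
  exact isUniform_rotate_capPoint hμ le_rfl h0.le hπ hθ.aemeasurable
    (hθ.map_eq.trans (angleLaw_eq_cond d h0 hπ)) hZ hind

theorem isUniform_rotate_cap {d : ℕ} {μ : EuclideanSpace ℝ (Fin (d + 2))} (hμ : ‖μ‖ = 1)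
    {θ₀ : ℝ} (h0 : 0 < θ₀) (hπ : θ₀ ≤ Real.pi) {Ω : Type*} [MeasurableSpace Ω] {P : Measure Ω}
    {X : Ω → EuclideanSpace ℝ (Fin (d + 2))}
    (hX : pdf.IsUniform X (cap (axis d) θ₀) P (surfaceMeasure (d + 2))) :
    pdf.IsUniform (fun ω => rotate μ (X ω)) (cap μ θ₀) P (surfaceMeasure (d + 2)) := by
  -- Uniformity on a set of positive finite mass already forces `X` to be a.e.-measurable.
  have hne : surfaceMeasure (d + 2) (cap (axis d) θ₀) ≠ 0 := by
    rw [surfaceMeasure_cap_axis d ⟨h0.le, hπ⟩]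
    simpa using mul_pos (sphereArea_pos (d + 1)) (solidFrac_pos d h0 hπ)
  have hXm := hX.aemeasurable hne (measure_ne_top _ _)
  rw [cap_eq_hollowCone (norm_axis d)] at hX
  rw [cap_eq_hollowCone hμ]
  exact isUniform_rotate hμ hXm hX

theorem lintegral_ops_rejection_le (d : ℕ) {θ₀ : ℝ} (h0 : 0 < θ₀) (hπ : θ₀ ≤ Real.pi)
    {Ω : Type*} [MeasurableSpace Ω] {P : Measure Ω} [IsProbabilityMeasure P]
    {U T : ℕ → Ω → ℝ} (h : IsRejectionSource P θ₀ U T) (Z : Fin (d + 1) → Ω → ℝ)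
    (μ : Fin (d + 2) → ℝ) :
    ∫⁻ ω, ((capPointAlg (rejectionAngleAlg d θ₀ (fun k => U k ω) (fun k => T k ω))
      (fun i => Z i ω) μ).ops : ℝ≥0∞) ∂P ≤ ((34 : ℕ) : ℝ≥0∞) * ((d : ℝ≥0∞) + 2) := by
  have hops : ∀ ω, ((capPointAlg (rejectionAngleAlg d θ₀ (fun k => U k ω) (fun k => T k ω))
      (fun i => Z i ω) μ).ops : ℝ≥0∞) = 8 *
        (rejectionPasses d θ₀ (fun k => U k ω) (fun k => T k ω) : ℝ≥0∞) +
        ((16 * d + 51 : ℕ) : ℝ≥0∞) := fun ω => by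
    rw [ops_capPointAlg, ops_rejectionAngleAlg]
    push_cast
    ring
  simp_rw [hops]
  rw [lintegral_add_right _ measurable_const, lintegral_const_mul' _ _ (by simp),
    h.lintegral_passes d h0 hπ, lintegral_const, measure_univ, mul_one]
  calc 8 * ENNReal.ofReal (θ₀ * Real.sin (min θ₀ (Real.pi / 2)) ^ d /
        (beta (((d : ℝ) + 1) / 2) (1 / 2) * solidFrac d θ₀)) + ((16 * d + 51 : ℕ) : ℝ≥0∞)
      ≤ 8 * ENNReal.ofReal ((2 * (d + 1) : ℕ) : ℝ) + ((16 * d + 51 : ℕ) : ℝ≥0∞) := by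
        gcongr
        push_cast
        exact expected_passes_le d h0 hπ
    _ = ((8 * (2 * (d + 1)) + (16 * d + 51) : ℕ) : ℝ≥0∞) := by
        rw [ENNReal.ofReal_natCast]; push_cast; ring
    -- The total is `32 * d + 67`; at `d = 0` no integer smaller than `34` would do.
    _ ≤ ((34 * (d + 2) : ℕ) : ℝ≥0∞) := by
        gcongr
        omega
    _ = _ := by push_cast; ring

theorem passes_formula (d : ℕ) (θ₀ : ℝ) :
    θ₀ * Real.sin (min θ₀ (Real.pi / 2)) ^ d /
        (beta (((d : ℝ) + 1) / 2) (1 / 2) * solidFrac d θ₀) =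
      1 / √Real.pi * (Real.Gamma (((d : ℝ) + 2) / 2) / Real.Gamma (((d : ℝ) + 1) / 2)) *
        (θ₀ * Real.sin (min θ₀ (Real.pi / 2)) ^ d / solidFrac d θ₀) := by
  have h : ((d : ℝ) + 1) / 2 + 1 / 2 = ((d : ℝ) + 2) / 2 := by ring
  rw [beta, h, Real.Gamma_one_half_eq]
  have h1 : Real.Gamma (((d : ℝ) + 1) / 2) ≠ 0 := (Real.Gamma_pos_of_pos (by positivity)).ne'
  have h2 : Real.Gamma (((d : ℝ) + 2) / 2) ≠ 0 := (Real.Gamma_pos_of_pos (by positivity)).ne'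
  have h3 : √Real.pi ≠ 0 := (Real.sqrt_pos.2 Real.pi_pos).ne'
  rcases eq_or_ne (solidFrac d θ₀) 0 with h4 | h4
  · simp [h4]
  · field_simp

/-- An affine image of a uniform variable is uniform. -/
theorem isUniform_affine {Ω : Type*} [MeasurableSpace Ω] {P : Measure Ω} [IsProbabilityMeasure P]
    {U : Ω → ℝ} (hU : pdf.IsUniform U (Icc 0 1) P) {a b : ℝ} (hab : a < b) :
    pdf.IsUniform (fun ω => U ω * (b - a) + a) (Icc a b) P := by
  have hUm := aemeasurable_of_isUniform_Icc zero_lt_one hU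
  have hba : 0 < b - a := sub_pos.2 hab
  have hm : Measurable fun u : ℝ => u * (b - a) + a := by fun_prop
  have : IsProbabilityMeasure (P.map fun ω => U ω * (b - a) + a) :=
    Measure.isProbabilityMeasure_map (by fun_prop)
  have hvol : (volume : Measure ℝ).map (fun u => u * (b - a) + a) =
      ENNReal.ofReal |(b - a)⁻¹| • volume := by
    have h1 : (fun u : ℝ => u * (b - a) + a) = (fun u => u + a) ∘ fun u => u * (b - a) := rfl
    rw [h1, ← Measure.map_map (by fun_prop) (by fun_prop),
      Real.map_volume_mul_right hba.ne', Measure.map_smul, map_add_right_eq_self]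
  have hpre : (fun u : ℝ => u * (b - a) + a) ⁻¹' Icc a b = Icc 0 1 := by
    ext u
    simp only [mem_preimage, mem_Icc]
    constructor
    · rintro ⟨h1, h2⟩
      constructor <;> nlinarith
    · rintro ⟨h1, h2⟩
      constructor <;> nlinarith
  refine eq_cond_of_eq_smul (c := (volume (Icc (0 : ℝ) 1))⁻¹ * ENNReal.ofReal |(b - a)⁻¹|) ?_
  have h := AEMeasurable.map_map_of_aemeasurable hm.aemeasurable hUm
  rw [hU, ProbabilityTheory.cond, Measure.map_smul, ← hpre,
    ← Measure.restrict_map hm measurableSet_Icc, hvol, Measure.restrict_smul, smul_smul, hpre] at h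
  exact h.symm

end CapSampling

/-! ### Assembly of the sampling and cost statements -/

theorem mainTheorem2 :
    ∃ C : ℕ,
      -- a point on the sphere of dimension `m + 1 ≥ 1`
      (∀ (m : ℕ) (Ω : Type u) [MeasurableSpace Ω] (P : Measure Ω) [IsProbabilityMeasure P]
        (Z : Fin (m + 1) → Ω → ℝ), IsStdNormalFamily P Z →
        pdf.IsUniform (fun ω => WithLp.toLp 2 (spherePointAlg fun i => Z i ω).val)
          (Metric.sphere 0 1) P (surfaceMeasure (m + 1))) ∧
      -- the map `Θ` and its inverse
      (∀ d : ℕ, StrictMonoOn (solidFrac d) (Icc 0 Real.pi) ∧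
        BijOn (solidFrac d) (Icc 0 Real.pi) (Icc 0 1) ∧
        InvOn (solidFracInv d) (solidFrac d)
          (Icc 0 Real.pi) (Icc 0 1)) ∧
      (∀ (d : ℕ) (μ : EuclideanSpace ℝ (Fin (d + 2))), ‖μ‖ = 1 → ∀ θ ∈ Icc 0 Real.pi,
        surfaceMeasure (d + 2) (cap μ θ) =
          ENNReal.ofReal (sphereArea (d + 2) * solidFrac d θ)) ∧
      -- the law of the planar angle: its density has total mass one, and its distribution function
      (∀ (d : ℕ) (θ₀ : ℝ), 0 < θ₀ → θ₀ ≤ Real.pi →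
        IsProbabilityMeasure (angleLaw d θ₀) ∧
        ∀ θ, 0 ≤ θ → angleLaw d θ₀ (Iic θ) = ENNReal.ofReal
          (if θ ≤ θ₀ then solidFrac d θ / solidFrac d θ₀ else 1)) ∧
      -- the planar angle by inverse transform
      (∀ (d : ℕ) (θ₀ : ℝ), 0 < θ₀ → θ₀ ≤ Real.pi →
        ∀ (Ω : Type u) [MeasurableSpace Ω] (P : Measure Ω) [IsProbabilityMeasure P] (U : Ω → ℝ),
        pdf.IsUniform U (Icc 0 (solidFrac d θ₀)) P →
        HasLaw (fun ω => solidFracInv d (U ω)) (angleLaw d θ₀) P) ∧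
      -- the planar angle by rejection: almost sure termination, law, average number of passes
      (∀ (d : ℕ) (θ₀ : ℝ), 0 < θ₀ → θ₀ ≤ Real.pi →
        ∀ (Ω : Type u) [MeasurableSpace Ω] (P : Measure Ω) [IsProbabilityMeasure P]
          (U T : ℕ → Ω → ℝ), IsRejectionSource P θ₀ U T →
        (∀ᵐ ω ∂P, ∃ k, (rejectionPass d (rejectionLevel d θ₀)
          (U k ω) (T k ω)).val) ∧
        HasLaw (fun ω =>
          (rejectionAngleAlg d θ₀ (fun k => U k ω) (fun k => T k ω)).val)
          (angleLaw d θ₀) P ∧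
        ∫⁻ ω, (rejectionPasses d θ₀ (fun k => U k ω) (fun k => T k ω) : ℝ≥0∞) ∂P =
          ENNReal.ofReal (1 / √Real.pi *
            (Real.Gamma (((d : ℝ) + 2) / 2) / Real.Gamma (((d : ℝ) + 1) / 2)) *
            (θ₀ * Real.sin (min θ₀ (Real.pi / 2)) ^ d / solidFrac d θ₀))) ∧
      -- the cap about the last canonical axis
      (∀ (d : ℕ) (θ₀ : ℝ), 0 < θ₀ → θ₀ ≤ Real.pi →
        ∀ (Ω : Type u) [MeasurableSpace Ω] (P : Measure Ω) [IsProbabilityMeasure P]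
          (θ : Ω → ℝ) (Z : Fin (d + 1) → Ω → ℝ),
        HasLaw θ (angleLaw d θ₀) P → IsStdNormalFamily P Z →
        IndepFun θ (fun ω i => Z i ω) P →
        pdf.IsUniform (fun ω => capPoint (θ ω) fun i => Z i ω)
          (cap (axis d) θ₀) P (surfaceMeasure (d + 2))) ∧
      -- the simple rotation
      (∀ (d : ℕ) (μ : EuclideanSpace ℝ (Fin (d + 2))), ‖μ‖ = 1 →
        (∀ x, WithLp.toLp 2 (rotateAlg x.ofLp μ.ofLp).val =
          rotate μ x) ∧
        (∀ x, ‖rotate μ x‖ = ‖x‖) ∧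
        rotate μ (axis d) = μ ∧
        (∀ x, inner ℝ x (axis d) = 0 → inner ℝ x μ = 0 → rotate μ x = x) ∧
        (∀ x, (rotate μ x).ofLp = rotationMatrix μ *ᵥ x.ofLp) ∧
        (μ ≠ -axis d →
          rotationMatrix μ ∈ Matrix.specialOrthogonalGroup (Fin (d + 2)) ℝ) ∧
        ∀ θ₀ : ℝ, 0 < θ₀ → θ₀ ≤ Real.pi →
          ∀ (Ω : Type u) [MeasurableSpace Ω] (P : Measure Ω) [IsProbabilityMeasure P]
            (X : Ω → EuclideanSpace ℝ (Fin (d + 2))),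
          pdf.IsUniform X (cap (axis d) θ₀) P
            (surfaceMeasure (d + 2)) →
          pdf.IsUniform (fun ω => rotate μ (X ω)) (cap μ θ₀) P
            (surfaceMeasure (d + 2))) ∧
      -- the overall algorithm with the inverse transform
      (∀ (d : ℕ) (μ : EuclideanSpace ℝ (Fin (d + 2))), ‖μ‖ = 1 →
        ∀ θ₀ : ℝ, 0 < θ₀ → θ₀ ≤ Real.pi →
        ∀ (Ω : Type u) [MeasurableSpace Ω] (P : Measure Ω) [IsProbabilityMeasure P]
          (U : Ω → ℝ) (Z : Fin (d + 1) → Ω → ℝ),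
        pdf.IsUniform U (Icc 0 (solidFrac d θ₀)) P →
        IsStdNormalFamily P Z → IndepFun U (fun ω i => Z i ω) P →
        pdf.IsUniform (fun ω => WithLp.toLp 2 (capPointAlg
            (inverseAngleAlg d θ₀ fun _ => U ω) (fun i => Z i ω) μ.ofLp).val)
          (cap μ θ₀) P (surfaceMeasure (d + 2)) ∧
        ∀ ω, (capPointAlg
          (inverseAngleAlg d θ₀ fun _ => U ω) (fun i => Z i ω) μ.ofLp).ops
            ≤ C * (d + 2)) ∧
      -- the overall algorithm with rejection
      (∀ (d : ℕ) (μ : EuclideanSpace ℝ (Fin (d + 2))), ‖μ‖ = 1 →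
        ∀ θ₀ : ℝ, 0 < θ₀ → θ₀ ≤ Real.pi →
        ∀ (Ω : Type u) [MeasurableSpace Ω] (P : Measure Ω) [IsProbabilityMeasure P]
          (U T : ℕ → Ω → ℝ) (Z : Fin (d + 1) → Ω → ℝ),
        IsRejectionSource P θ₀ U T →
        IsStdNormalFamily P Z →
        IndepFun (fun ω k => (U k ω, T k ω)) (fun ω i => Z i ω) P →
        pdf.IsUniform (fun ω => WithLp.toLp 2 (capPointAlg
            (rejectionAngleAlg d θ₀ (fun k => U k ω) (fun k => T k ω))
            (fun i => Z i ω) μ.ofLp).val)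
          (cap μ θ₀) P (surfaceMeasure (d + 2)) ∧
        ∫⁻ ω, ((capPointAlg
            (rejectionAngleAlg d θ₀ (fun k => U k ω) (fun k => T k ω))
            (fun i => Z i ω) μ.ofLp).ops : ℝ≥0∞) ∂P
          ≤ (C : ℝ≥0∞) * ((d : ℝ≥0∞) + 2)) ∧
      -- the hollow cone
      (∀ (d : ℕ) (μ : EuclideanSpace ℝ (Fin (d + 2))), ‖μ‖ = 1 →
        ∀ Ω₁ Ω₂ : ℝ, 0 ≤ Ω₁ → Ω₁ < Ω₂ → Ω₂ ≤ 1 →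
        ∀ (Ω : Type u) [MeasurableSpace Ω] (P : Measure Ω) [IsProbabilityMeasure P]
          (U : Ω → ℝ) (Z : Fin (d + 1) → Ω → ℝ),
        pdf.IsUniform U (Icc 0 1) P →
        IsStdNormalFamily P Z → IndepFun U (fun ω i => Z i ω) P →
        pdf.IsUniform (fun ω => rotate μ (capPoint
            (solidFracInv d (U ω * (Ω₂ - Ω₁) + Ω₁)) fun i => Z i ω))
          (hollowCone μ (solidFracInv d Ω₁)
            (solidFracInv d Ω₂)) P (surfaceMeasure (d + 2)) ∧
        ∀ ω, WithLp.toLp 2 (capPointAlg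
            (hollowAngleAlg d Ω₁ Ω₂ (U ω)) (fun i => Z i ω) μ.ofLp).val =
          rotate μ (capPoint
            (solidFracInv d (U ω * (Ω₂ - Ω₁) + Ω₁)) fun i => Z i ω) ∧
        (capPointAlg
          (hollowAngleAlg d Ω₁ Ω₂ (U ω)) (fun i => Z i ω) μ.ofLp).ops
            ≤ C * (d + 2)) := by
  -- The rejection variant dictates the constant; the other two use `16 * d + 50` and `16 * d + 52`
  -- operations.
  refine ⟨34, ?_, ?_, ?_, ?_, ?_, ?_, ?_, ?_, ?_, ?_, ?_⟩
  · intro m Ω _ P _ Z hZ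
    exact hZ.map_normalized.trans (cond_surfaceMeasure_sphere (m + 1)).symm
  · exact fun d => ⟨strictMonoOn_solidFrac d, bijOn_solidFrac d, invOn_solidFracInv d⟩
  · exact fun d μ hμ θ hθ => surfaceMeasure_cap hμ hθ
  · exact fun d θ₀ h0 hπ =>
      ⟨isProbabilityMeasure_angleLaw d h0 hπ, fun θ hθ => angleLaw_Iic d h0 hπ hθ⟩
  · exact fun d θ₀ h0 hπ Ω _ P _ U hU => hasLaw_solidFracInv d h0 hπ hU
  · intro d θ₀ h0 hπ Ω _ P _ U T h
    -- The stopping test and the returned angle unfold to `acceptSet` and `acceptedAngle`.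
    refine ⟨h.ae_exists_accept d h0 hπ, h.hasLaw d h0 hπ, ?_⟩
    rw [h.lintegral_passes d h0 hπ, passes_formula]
  · intro d θ₀ h0 hπ Ω _ P _ θ Z hθ hZ hind
    rw [cap_eq_hollowCone (norm_axis d)]
    exact isUniform_capPoint d le_rfl h0.le hπ hθ.aemeasurable
      (hθ.map_eq.trans (angleLaw_eq_cond d h0 hπ)) hZ hind
  · intro d μ hμ
    exact ⟨toLp_val_rotateAlg hμ, norm_rotate hμ, rotate_axis hμ,
      fun x => rotate_eq_self_of_inner_eq_zero μ, rotate_ofLp μ, rotationMatrix_mem hμ,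
      fun θ₀ h0 hπ Ω _ P _ X hX => isUniform_rotate_cap hμ h0 hπ hX⟩
  · intro d μ hμ θ₀ h0 hπ Ω _ P _ U Z hU hZ hind
    refine ⟨?_, fun ω => ?_⟩
    · simp_rw [toLp_val_capPointAlg hμ]
      exact isUniform_rotate_capPoint_cap hμ h0 hπ (hasLaw_solidFracInv d h0 hπ hU) hZ
        (hind.comp (measurable_solidFracInv d) measurable_id)
    · rw [ops_capPointAlg, ops_inverseAngleAlg]
      omega
  · intro d μ hμ θ₀ h0 hπ Ω _ P _ U T Z hUT hZ hind
    refine ⟨?_, lintegral_ops_rejection_le d h0 hπ hUT Z μ.ofLp⟩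
    simp_rw [toLp_val_capPointAlg hμ]
    -- The accepted angle is a measurable function of the whole sequence of draws, hence independent
    -- of the normals.
    exact isUniform_rotate_capPoint_cap hμ h0 hπ (hUT.hasLaw d h0 hπ) hZ
      (hind.comp (measurable_acceptedAngle d θ₀) measurable_id)
  · intro d μ hμ Ω₁ Ω₂ h0 h12 h1 Ω _ P _ U Z hU hZ hind
    have hΩ₁ : Ω₁ ∈ Icc (0 : ℝ) 1 := ⟨h0, h12.le.trans h1⟩
    have hΩ₂ : Ω₂ ∈ Icc (0 : ℝ) 1 := ⟨h0.trans h12.le, h1⟩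
    have hUm := aemeasurable_of_isUniform_Icc zero_lt_one hU
    refine ⟨isUniform_rotate_capPoint hμ (solidFracInv_mem d hΩ₁).1
      ((solidFracInv_strictMonoOn d).monotoneOn hΩ₁ hΩ₂ h12.le) (solidFracInv_mem d hΩ₂).2
      ((measurable_solidFracInv d).comp_aemeasurable (by fun_prop))
      (map_solidFracInv_of_isUniform d h0 h12 h1 (isUniform_affine hU h12)) hZ
      (hind.comp (φ := fun u => solidFracInv d (u * (Ω₂ - Ω₁) + Ω₁))
        ((measurable_solidFracInv d).comp (by fun_prop)) measurable_id), fun ω => ⟨?_, ?_⟩⟩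
    · exact toLp_val_capPointAlg hμ _ _
    · rw [ops_capPointAlg, ops_hollowAngleAlg]
      omega
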